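/- **Setting.** Let $N=\{1,\dots,n\}$ ($n\ge 1$) be a set of agents and $M$ a set of $m$ indivisible goods. Agent $i$ has an additive valuation given by item values $v_i(e)\ge 0$. Let $\mathcal G=(G_1,\dots,G_g)$ be a family of protected groups $G_k\subseteq N$. An integral allocation is a vector $A=(A_1,\dots,A_n)$ of pairwise disjoint bundles $A_i\subseteq M$ (items may stay unallocated), and the welfare of a group $G$ is $w_G(A)=\sum_{i\in G}\sum_{e\in A_i}v_i(e)$. For $G\subseteq N$, $e\in M$ and $B\subseteq M$ put $v_G(e)=\max_{i\in G}v_i(e)$ (which is $0$ if $G=\emptyset$) and $v_G(B)=\sum_{e\in B}v_G(e)$. The proportional share of $G$ is $PS(G)=\frac{|G|}{n}\,v_G(M)$, and its anyprice share is $$APS(G)=\min_{p}\ \max_{B\subseteq M}\Big\{v_G(B):\ \sum_{e\in B}p_e\le \tfrac{|G|}{n}\Big\},$$ where $p$ ranges over the price vectors $(p_e)_{e\in M}$ with $p_e\ge 0$ and $\sum_{e\in M}p_e=1$ (and $APS(G)=0$ if $m=0$). The instance is dichotomous if $v_i(e)\in\{0,1\}$ for all $i$ and $e$, and $\mathcal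 G$ is laminar if any two of its groups are disjoint or one contains the other. **Theorem.** For every instance with dichotomous valuations and a laminar family $\mathcal G$ there is an integral allocation $A$ with $w_G(A)\ge APS(G)$ for every $G\in\mathcal G$. Moreover, there is one randomized algorithm, running in time polynomial in $n$, $m$ and $g$, which on every such instance always (that is, for every outcome of its random choices) outputs an integral allocation $A$ with $w_G(A)\ge APS(G)$ for every $G\in\mathcal G$, and whose random output satisfies $\mathbb E[w_G(A)]\ge PS(G)$ for every $G\in\mathcal G$. Here a randomized algorithm is a fixed program for a random access machine whose memory cells hold natural numbers. Each elementary command takes one step: an assignment (with expressions built from constants, indexed memory reads, addition and truncated subtraction), a conditional or loop test, or a draw of a uniformly random element of $\{0,\dots,k\}$ for a computed number $k$. The number of steps is bounded by a polynomial in $n+m+g$ for every outcome of the draws. -/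

import Mathlib

open scoped NNReal

noncomputable section

namespace FairGroups

/-! ### Allocation instances with protected groups -/

/-- Agents `Fin n`, items `Fin m`, additive valuations given by the item values `v i e ≥ 0`,
and a reference family `group 0, …, group (g - 1)` of protected groups. -/
structure AllocInstance (n m g : ℕ) where
  v : Fin n → Fin m → ℝ≥0
  group : Fin g → Finset (Fin n)

/-- A vector of `n` bundles of items. -/
abbrev Bundles (n m : ℕ) : Type := Fin n → Finset (Fin m)

/-- An integral allocation is a vector of pairwise disjoint bundles
(items may stay unallocated). -/
def IsAllocation {n m : ℕ} (A : Bundles n m) : Prop :=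
  ∀ i j, i ≠ j → Disjoint (A i) (A j)

namespace AllocInstance

variable {n m g : ℕ} (I : AllocInstance n m g)

/-- Every agent values every item at `0` or `1`. -/
def Dichotomous : Prop := ∀ i e, I.v i e = 0 ∨ I.v i e = 1

/-- Any two protected groups are disjoint or nested. -/
def Laminar : Prop :=
  ∀ k l, Disjoint (I.group k) (I.group l) ∨ I.group k ⊆ I.group l ∨ I.group l ⊆ I.group k

/-- Welfare of agent `i`: the value of her bundle. -/
def welfare (A : Bundles n m) (i : Fin n) : ℝ≥0 := ∑ e ∈ A i, I.v i e

/-- Welfare of the group `G`: the total welfare of its members. -/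
def groupWelfare (A : Bundles n m) (G : Finset (Fin n)) : ℝ≥0 := ∑ i ∈ G, I.welfare A i

/-- `v_G(e) = max_{i ∈ G} v_i(e)` (and `0` for the empty group). -/
def groupItemValue (G : Finset (Fin n)) (e : Fin m) : ℝ≥0 := G.sup fun i => I.v i e

/-- `v_G(B) = ∑_{e ∈ B} v_G(e)`. -/
def groupValue (G : Finset (Fin n)) (B : Finset (Fin m)) : ℝ≥0 :=
  ∑ e ∈ B, I.groupItemValue G e

/-- The proportional share `(|G| / n) * v_G(M)`, where `M` is the set of all items. -/
def propShare (G : Finset (Fin n)) : ℝ≥0 :=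
  (G.card : ℝ≥0) / (n : ℝ≥0) * I.groupValue G Finset.univ

/-- Nonnegative prices of total `1`. -/
def Prices (m : ℕ) : Set (Fin m → ℝ≥0) := {p | ∑ e, p e = 1}

/-- The bundles that `G` can buy at prices `p` with the budget `|G| / n`. -/
def affordable (p : Fin m → ℝ≥0) (G : Finset (Fin n)) : Finset (Finset (Fin m)) :=
  Finset.univ.filter fun B => ∑ e ∈ B, p e ≤ (G.card : ℝ≥0) / (n : ℝ≥0)

/-- The largest value for `G` of a bundle that it can buy at prices `p`
(the empty bundle is always affordable). -/
def bestValue (G : Finset (Fin n)) (p : Fin m → ℝ≥0) : ℝ≥0 :=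
  (affordable p G).sup fun B => I.groupValue G B

/-- The anyprice share: the minimum over all price vectors of the value of the best affordable
bundle. It is a minimum by `isLeast_anyPriceShare`; without items it is `0`. -/
def anyPriceShare (G : Finset (Fin n)) : ℝ≥0 := sInf (I.bestValue G '' Prices m)

theorem isLeast_anyPriceShare (hm : 0 < m) (G : Finset (Fin n)) :
    IsLeast (I.bestValue G '' Prices m) (I.anyPriceShare G) := by
  have hne : (I.bestValue G '' Prices m).Nonempty := by
    refine Set.Nonempty.image _ ⟨Pi.single ⟨0, hm⟩ 1, ?_⟩
    simp [Prices]
  have hfin : (I.bestValue G '' Prices m).Finite := by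
    refine (Set.finite_range fun T : Finset (Finset (Fin m)) =>
      T.sup fun B => I.groupValue G B).subset ?_
    rintro _ ⟨p, -, rfl⟩
    exact ⟨affordable p G, rfl⟩
  exact ⟨hne.csInf_mem hfin, fun x hx => csInf_le' hx⟩

/-- `A` is an integral allocation that gives every protected group its anyprice share. -/
def IsAPSFair (A : Bundles n m) : Prop :=
  IsAllocation A ∧ ∀ k, I.anyPriceShare (I.group k) ≤ I.groupWelfare A (I.group k)

end AllocInstance

/-! ### Randomized algorithms with a step count

Programs of a random access machine. The memory consists of cells `a[i, j]` that hold natural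
numbers. One step executes one command; the arithmetic is addition and truncated subtraction
(no multiplication, so that a number can at most grow by a constant factor in one step).
-/

/-- `s a i j` is the content of the cell `a[i, j]`. -/
abbrev Store : Type := ℕ → ℕ → ℕ → ℕ

def Store.write (s : Store) (a i j x : ℕ) : Store :=
  fun a' i' j' => if a' = a ∧ i' = i ∧ j' = j then x else s a' i' j'

/-- Expressions; array names `a` are literals, indices may be computed. -/
inductive Expr : Type
  | const (c : ℕ)
  | read (a : ℕ) (i j : Expr)
  | add (x y : Expr)
  | sub (x y : Expr)

def Expr.eval (s : Store) : Expr → ℕ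
  | .const c => c
  | .read a i j => s a (i.eval s) (j.eval s)
  | .add x y => x.eval s + y.eval s
  | .sub x y => x.eval s - y.eval s

inductive Cmd : Type
  /-- do nothing -/
  | skip
  /-- `a[i, j] := x` -/
  | assign (a : ℕ) (i j x : Expr)
  /-- `a[i, j] :=` an independent uniformly random element of `{0, …, x}` -/
  | draw (a : ℕ) (i j x : Expr)
  /-- first `c`, then `d` -/
  | seq (c d : Cmd)
  /-- if `x ≠ 0` then `c` else `d` -/
  | branch (x : Expr) (c d : Cmd)
  /-- while `x ≠ 0` do `c` -/
  | loop (x : Expr) (c : Cmd)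

/-- A configuration: the commands that remain to be executed, and the memory. -/
abbrev Config : Type := List Cmd × Store

/-- One step of the machine; it has halted when no command remains. -/
def step : Config → PMF Config
  | ([], s) => PMF.pure ([], s)
  | (.skip :: k, s) => PMF.pure (k, s)
  | (.assign a i j x :: k, s) =>
      PMF.pure (k, s.write a (i.eval s) (j.eval s) (x.eval s))
  | (.draw a i j x :: k, s) =>
      (PMF.uniformOfFinset (Finset.range (x.eval s + 1)) Finset.nonempty_range_add_one).map
        fun r => (k, s.write a (i.eval s) (j.eval s) r)
  | (.seq c d :: k, s) => PMF.pure (c :: d :: k, s)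
  | (.branch x c d :: k, s) => PMF.pure ((if x.eval s ≠ 0 then c else d) :: k, s)
  | (.loop x c :: k, s) => PMF.pure (if x.eval s ≠ 0 then c :: .loop x c :: k else k, s)

/-- The distribution of the configuration after `t` steps. -/
def runFor : ℕ → Config → PMF Config
  | 0, c => PMF.pure c
  | t + 1, c => (step c).bind (runFor t)

/-- On the initial memory `s`, the program `P` halts within `t` steps, whatever it draws. -/
def HaltsWithin (P : Cmd) (s : Store) (t : ℕ) : Prop :=
  ∀ c ∈ (runFor t ([P], s)).support, c.1 = []

/-- The input memory: `n`, `m`, `g` in the cells `0[0, 0]`, `0[1, 0]`, `0[2, 0]`, the value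
`v i e` in `1[i, e]`, and `1` in `2[k, i]` if agent `i` is in the `k`-th group; all other cells
hold `0`. The floor leaves the values of a dichotomous instance unchanged. -/
def AllocInstance.input {n m g : ℕ} (I : AllocInstance n m g) : Store
  | 0, 0, 0 => n
  | 0, 1, 0 => m
  | 0, 2, 0 => g
  | 1, i, e => if h : i < n ∧ e < m then ⌊I.v ⟨i, h.1⟩ ⟨e, h.2⟩⌋₊ else 0
  | 2, k, i =>
      if h : k < g ∧ i < n then (if (⟨i, h.2⟩ : Fin n) ∈ I.group ⟨k, h.1⟩ then 1 else 0) else 0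
  | _, _, _ => 0

/-- The bundles written in the output array: `e ∈ A i` if and only if `3[i, e] = 1`. -/
def outputBundles (n m : ℕ) (s : Store) : Bundles n m :=
  fun i => Finset.univ.filter fun e => s 3 i e = 1

/-- The distribution of the bundles in the output array after `t` steps of `P` on the input `I`. -/
def outputAfter {n m g : ℕ} (P : Cmd) (I : AllocInstance n m g) (t : ℕ) : PMF (Bundles n m) :=
  (runFor t ([P], I.input)).map fun c => outputBundles n m c.2

/-- Expected welfare of the group `G` under a random vector of bundles. -/
def AllocInstance.expectedGroupWelfare {n m g : ℕ} (I : AllocInstance n m g)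
    (μ : PMF (Bundles n m)) (G : Finset (Fin n)) : ℝ :=
  ∑ A, (μ A).toReal * (I.groupWelfare A G : ℝ)

end FairGroups

end

/-!
For a dichotomous instance let `c` be the number of items that some member of `G` wants. With
equal prices for these items `APS(G) ≤ ⌊|G| c / n⌋` (`anyPriceShare_le`), while
`PS(G) = |G| c / n`. So it suffices to find `n` allocations, called colours, such that every
protected group gets on average at least its proportional share, and such that its welfare in
different colours differs by at most one: then a uniformly random colour is as required
(`IsTable.isAPSFair`, `IsTable.propShare_le`).

*A fractional solution.* Cut every item `e` into `n` copies, one for each agent. The copy of the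
agent `j` goes to someone who wants `e` in the smallest group that contains `j` and wants `e`; the
set of all agents is added to the family, so that there is such a group whenever anybody wants
`e`. By laminarity every group that wants `e` then gets at least as many copies of `e` as it has
members, since the copies of its members remain inside (`IsRow.update`). Giving the `n` copies of
each item the colours `0, …, n - 1` yields a table with the right averages, and
exchanging colours between copies of the same item preserves the averages.

*Balancing two colours* `a` and `b`. The item `e` is an arc from the agent that gets its copy
of colour `a` to the agent that gets its copy of colour `b`, and exchanging the colours reverses
the arc. The arcs are to be reversed such that every group `G` of the laminar family has as many
arcs leaving as entering it, up to one. To this end the arcs are joined to trails: the groups are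
treated from the smallest to the largest, and as long as two trails have exactly one end in the
group at hand, one of them is reversed if need be and they are joined at these ends. (A trail may
jump between two agents of a treated group.) For a group that is yet to be treated a trail counts
like an arc between its ends, because no joint separates its two agents; once a group has been
treated, at most one trail is unbalanced in it, and by at most one, and neither reversing nor
joining trails can spoil that. This is `IsTrailSystem`, with `IsTrailSystem.reverse`,
`IsTrailSystem.merge` and `IsTrailSystem.treat`.

*Balancing all colours.* As long as some group tells two colours apart by at least two, these
colours are balanced. This lowers the sum of the squares of the welfare of all groups in all
colours (`IsExchange.potential_lt`), which is polynomial in `n + m + g` (`potential_le`).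

*The machine.* The program draws only once, at the end, so the bulk of it is deterministic and is
verified with the weakest preconditions `Wp`. A bound on its time is read off from its syntax
(`Cmd.time`), given a bound `N` on the iterations of each single loop, and is polynomial in `N`
(`Cmd.exists_polynomial_time`). Commands leave alone the arrays that they do not mention as a
target (`Exec.eq_of_writes_eq_false`). Besides the input and output arrays `0`, `1`, `2` and `3`
the program uses the arrays

* `4[e, c]`: the table, with the agent that gets the copy of colour `c` of the item `e`, or `n` if
  no agent gets it;
* `5[l, 0]`: the groups in the order of their size; the variable `11` is the length of this list;
* `6[c, 0]`, `7[c, 0]`, `8[e, 0]`: the tail and the head of the trail `c`, and the trail of the item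
  `e`;

and scalar variables `10, …, 42`, such as the group `24` and the colours `25` and `26` that are
inspected.
-/

open scoped NNReal
noncomputable section

namespace FairGroups

/-! ### Deterministic runs, their time and their effect -/

theorem Store.write_apply (s : Store) (a i j x i' j' : ℕ) :
    s.write a i j x a i' j' = if i' = i ∧ j' = j then x else s a i' j' := by
  simp [Store.write]

@[simp] theorem Store.write_self (s : Store) (a i j x : ℕ) : s.write a i j x a i j = x := by
  simp [Store.write]

@[simp] theorem Store.write_of_ne (s : Store) {a a' : ℕ} (h : a' ≠ a) (i j x : ℕ) :
    s.write a i j x a' = s a' := by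
  funext i' j'
  simp [Store.write, h]

/-- `Exec c s s' t`: the command `c` draws nothing on the memory `s`, and ends after `t` steps
with the memory `s'`. -/
inductive Exec : Cmd → Store → Store → ℕ → Prop
  | skip (s) : Exec .skip s s 1
  | assign (a i j x s) :
      Exec (.assign a i j x) s (s.write a (i.eval s) (j.eval s) (x.eval s)) 1
  | seq {c d s s' s'' t t'} : Exec c s s' t → Exec d s' s'' t' →
      Exec (.seq c d) s s'' (1 + t + t')
  | branch_of_ne {x c d s s' t} : x.eval s ≠ 0 → Exec c s s' t →
      Exec (.branch x c d) s s' (1 + t)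
  | branch_of_eq {x c d s s' t} : x.eval s = 0 → Exec d s s' t →
      Exec (.branch x c d) s s' (1 + t)
  | loop_of_ne {x c s s' s'' t t'} : x.eval s ≠ 0 → Exec c s s' t →
      Exec (.loop x c) s' s'' t' → Exec (.loop x c) s s'' (1 + t + t')
  | loop_of_eq {x c s} : x.eval s = 0 → Exec (.loop x c) s s 1

theorem runFor_one_add_of_step {c c' : Config} (h : step c = PMF.pure c') (u : ℕ) :
    runFor (1 + u) c = runFor u c' := by
  rw [Nat.add_comm, runFor, h, PMF.pure_bind]

theorem Exec.runFor_add {c : Cmd} {s s' : Store} {t : ℕ} (h : Exec c s s' t) :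
    ∀ (k : List Cmd) (u : ℕ), runFor (t + u) (c :: k, s) = runFor u (k, s') := by
  induction h with
  | skip | assign => intro k u; exact runFor_one_add_of_step rfl u
  | seq _ _ h₁ h₂ =>
    intro k u
    rw [Nat.add_assoc, Nat.add_assoc, runFor_one_add_of_step rfl, h₁, h₂]
  | branch_of_ne hx _ h₁ =>
    intro k u
    rw [Nat.add_assoc, runFor_one_add_of_step rfl, if_pos hx, h₁]
  | branch_of_eq hx _ h₁ =>
    intro k u
    rw [Nat.add_assoc, runFor_one_add_of_step rfl, if_neg (not_not.2 hx), h₁]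
  | loop_of_ne hx _ _ h₁ h₂ =>
    intro k u
    rw [Nat.add_assoc, Nat.add_assoc, runFor_one_add_of_step rfl, if_pos hx, h₁, h₂]
  | loop_of_eq hx =>
    intro k u
    rw [runFor_one_add_of_step rfl, if_neg (not_not.2 hx)]

theorem runFor_halted (t : ℕ) (s : Store) : runFor t ([], s) = PMF.pure ([], s) := by
  induction t with
  | zero => rfl
  | succ t ih => rw [Nat.add_comm, runFor_one_add_of_step rfl, ih]

/-- Whether the array `a` is the target of some assignment or draw in the command. -/
def Cmd.writes (a : ℕ) : Cmd → Bool
  | .skip => false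
  | .assign b _ _ _ => a == b
  | .draw b _ _ _ => a == b
  | .seq c d => c.writes a || d.writes a
  | .branch _ c d => c.writes a || d.writes a
  | .loop _ c => c.writes a

theorem Exec.eq_of_writes_eq_false {c : Cmd} {s s' : Store} {t : ℕ} (h : Exec c s s' t) {a : ℕ}
    (ha : c.writes a = false) : s' a = s a := by
  induction h with
  | skip | loop_of_eq => rfl
  | assign =>
    refine Store.write_of_ne _ ?_ _ _ _
    simpa [Cmd.writes] using ha
  | seq _ _ h₁ h₂ =>
    simp only [Cmd.writes, Bool.or_eq_false_iff] at ha
    rw [h₂ ha.2, h₁ ha.1]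
  | branch_of_ne _ _ h₁ =>
    simp only [Cmd.writes, Bool.or_eq_false_iff] at ha
    exact h₁ ha.1
  | branch_of_eq _ _ h₁ =>
    simp only [Cmd.writes, Bool.or_eq_false_iff] at ha
    exact h₁ ha.2
  | loop_of_ne _ _ _ h₁ h₂ => rw [h₂ ha, h₁ ha]

/-- A bound on the number of steps of the command when every loop in it makes at most `N`
iterations. -/
def Cmd.time (N : ℕ) : Cmd → ℕ
  | .skip => 1
  | .assign _ _ _ _ => 1
  | .draw _ _ _ _ => 1
  | .seq c d => 1 + c.time N + d.time N
  | .branch _ c d => 1 + (c.time N + d.time N)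
  | .loop _ c => N * (1 + c.time N) + 1

theorem Cmd.exists_polynomial_time (c : Cmd) : ∃ q : Polynomial ℕ, ∀ N, c.time N = q.eval N := by
  induction c with
  | skip | assign | draw => exact ⟨1, fun N => by simp [Cmd.time]⟩
  | seq c d hc hd =>
    obtain ⟨p, hp⟩ := hc
    obtain ⟨q, hq⟩ := hd
    exact ⟨1 + p + q, fun N => by simp [Cmd.time, hp, hq]⟩
  | branch x c d hc hd =>
    obtain ⟨p, hp⟩ := hc
    obtain ⟨q, hq⟩ := hd
    exact ⟨1 + (p + q), fun N => by simp [Cmd.time, hp, hq]⟩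
  | loop x c hc =>
    obtain ⟨p, hp⟩ := hc
    exact ⟨.X * (1 + p) + 1, fun N => by simp [Cmd.time, hp]⟩

/-- The weakest precondition for total correctness within the time bound `Cmd.time N`: from `s`
the command `c` ends, without a draw and in time, in a memory that satisfies `Q`. -/
def Wp (N : ℕ) (c : Cmd) (Q : Store → Prop) (s : Store) : Prop :=
  ∃ s' t, Exec c s s' t ∧ t ≤ c.time N ∧ Q s'

section Wp

variable {N : ℕ} {c d : Cmd} {Q R : Store → Prop} {s : Store}

/-- A command leaves alone the arrays that it does not write, so this may be assumed when the
postcondition is weakened. -/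
theorem Wp.mono (h : Wp N c Q s)
    (hQ : ∀ s', (∀ a, c.writes a = false → s' a = s a) → Q s' → R s') : Wp N c R s := by
  obtain ⟨s', t, he, ht, hq⟩ := h
  exact ⟨s', t, he, ht, hQ s' (fun a ha => he.eq_of_writes_eq_false ha) hq⟩

theorem wp_skip (h : Q s) : Wp N .skip Q s := ⟨s, 1, .skip s, le_rfl, h⟩

theorem wp_assign {a : ℕ} {i j x : Expr} (h : Q (s.write a (i.eval s) (j.eval s) (x.eval s))) :
    Wp N (.assign a i j x) Q s := ⟨_, 1, .assign .., le_rfl, h⟩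

theorem wp_seq (h : Wp N c (Wp N d Q) s) : Wp N (.seq c d) Q s := by
  obtain ⟨s', t, he, ht, s'', t', he', ht', hq⟩ := h
  exact ⟨s'', _, .seq he he', by simp only [Cmd.time]; omega, hq⟩

theorem wp_branch {x : Expr} (hc : x.eval s ≠ 0 → Wp N c Q s) (hd : x.eval s = 0 → Wp N d Q s) :
    Wp N (.branch x c d) Q s := by
  by_cases hx : x.eval s = 0
  · obtain ⟨s', t, he, ht, hq⟩ := hd hx
    exact ⟨s', _, .branch_of_eq hx he, by simp only [Cmd.time]; omega, hq⟩
  · obtain ⟨s', t, he, ht, hq⟩ := hc hx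
    exact ⟨s', _, .branch_of_ne hx he, by simp only [Cmd.time]; omega, hq⟩

/-- The loop rule; the index of the invariant `I` is a variant that bounds the number of
iterations to come. -/
theorem wp_loop {x : Expr} (I : ℕ → Store → Prop)
    (hI : ∀ i s, I i s → x.eval s ≠ 0 → Wp N c (fun s' => ∃ j < i, I j s') s)
    {i : ℕ} (hi : i ≤ N) (h : I i s) :
    Wp N (.loop x c) (fun s' => x.eval s' = 0 ∧ ∃ j, I j s') s := by
  suffices H : ∃ s' t, Exec (.loop x c) s s' t ∧ t ≤ i * (1 + c.time N) + 1 ∧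
      (x.eval s' = 0 ∧ ∃ j, I j s') by
    obtain ⟨s', t, he, ht, hq⟩ := H
    refine ⟨s', t, he, ht.trans ?_, hq⟩
    simp only [Cmd.time]
    gcongr
  clear hi
  induction i using Nat.strong_induction_on generalizing s with
  | _ i ih =>
    by_cases hx : x.eval s = 0
    · exact ⟨s, 1, .loop_of_eq hx, by omega, hx, i, h⟩
    · obtain ⟨s', t, he, ht, j, hj, hIj⟩ := hI i s h hx
      obtain ⟨s'', t', he', ht', hq⟩ := ih j hj hIj
      refine ⟨s'', _, .loop_of_ne hx he he', ?_, hq⟩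
      have : (j + 1) * (1 + c.time N) ≤ i * (1 + c.time N) := by gcongr; omega
      rw [Nat.add_mul] at this
      omega

end Wp

/-- The scalar variable `v`, kept in the cell `v[0, 0]`. -/
abbrev Expr.var (v : ℕ) : Expr := .read v (.const 0) (.const 0)

/-- `|x - y|`, which is nonzero if and only if `x` and `y` differ. -/
abbrev Expr.dist (x y : Expr) : Expr := .add (.sub x y) (.sub y x)

theorem Expr.eval_dist_eq_zero {x y : Expr} {s : Store} :
    (Expr.dist x y).eval s = 0 ↔ x.eval s = y.eval s := by
  simp only [Expr.eval]
  omega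

/-- Assignment to a scalar variable. -/
abbrev Cmd.set (v : ℕ) (x : Expr) : Cmd := .assign v (.const 0) (.const 0) x

/-- `for v = 0, …, x - 1 do c` -/
def Cmd.forBelow (v : ℕ) (x : Expr) (c : Cmd) : Cmd :=
  .seq (.set v (.const 0))
    (.loop (.sub x (.var v)) (.seq c (.set v (.add (.var v) (.const 1)))))

/-- The rule for counting loops. Besides the invariant `I`, the body may assume that the arrays
which the loop does not write are as before the loop. For a closed command, `writes` evaluates by
`rfl`. -/
theorem wp_forBelow {N v h : ℕ} {x : Expr} {c : Cmd} {s : Store} (I : ℕ → Store → Prop)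
    (hv : c.writes v = false) (hN : h ≤ N)
    (hx : ∀ s', (∀ a, (Cmd.forBelow v x c).writes a = false → s' a = s a) → x.eval s' = h)
    (hI : ∀ i s' y, I i s' → I i (s'.write v 0 0 y)) (h0 : I 0 s)
    (body : ∀ i s', i < h → (∀ a, (Cmd.forBelow v x c).writes a = false → s' a = s a) →
      s' v 0 0 = i → I i s' → Wp N c (I (i + 1)) s') :
    Wp N (.forBelow v x c) (I h) s := by
  have hfr : ∀ a, (Cmd.forBelow v x c).writes a = false ↔ a ≠ v ∧ c.writes a = false := by
    intro a
    simp only [Cmd.forBelow, Cmd.writes, Bool.or_eq_false_iff, beq_eq_false_iff_ne, ne_eq]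
    tauto
  refine wp_seq (wp_assign ?_)
  refine (wp_loop (i := h) (fun j s' => ∃ i, i + j = h ∧ s' v 0 0 = i ∧ I i s' ∧
    ∀ a, (Cmd.forBelow v x c).writes a = false → s' a = s a) ?_ hN ?_).mono ?_
  · rintro j s' ⟨i, hij, hvi, hIi, hf⟩ hne
    have hlt : i < h := by
      have hxs := hx s' hf
      simp only [Expr.eval, hxs, hvi] at hne
      omega
    refine wp_seq ((body i s' hlt hf hvi hIi).mono fun s'' hf' hI' => ?_)
    refine wp_assign ⟨j - 1, by omega, i + 1, by omega, ?_, hI _ _ _ hI', ?_⟩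
    · simp [Expr.eval, hf' v hv, hvi]
    · intro a ha
      rw [Expr.eval, Store.write_of_ne _ ((hfr a).1 ha).1, hf' a ((hfr a).1 ha).2, hf a ha]
  · refine ⟨0, by omega, by simp [Expr.eval], hI _ _ _ h0, fun a ha => ?_⟩
    rw [Expr.eval, Store.write_of_ne _ ((hfr a).1 ha).1]
  · rintro s' - ⟨he, j, i, hij, hvi, hIi, hf⟩
    have hxs := hx s' hf
    simp only [Expr.eval, hxs, hvi] at he
    obtain rfl : i = h := by omega
    exact hIi

/-! ### Balancing two colours by joining trails -/

/-- `∑ (δ (p e) - δ (q e))` over the items `e < m` of the trail `c`, that is, with label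
`L e = c`. -/
def trailDiff (m : ℕ) (p q L δ : ℕ → ℕ) (c : ℕ) : ℤ :=
  ∑ e ∈ Finset.range m, if L e = c then (δ (p e) : ℤ) - δ (q e) else 0

/-- The invariant of balancing. Each item `e < m` is an arc from the agent `p e` to the agent
`q e`, the labels `L` collect the items into trails, and the trail `c` has the ends `tl c` and
`hd c`. The groups have the indicator functions `H 0, …, H (P - 1)`, and the first `r` of them
have been treated. For a group still to be treated, a trail counts like a single arc from its tail
to its head; for a treated one, at most one trail is unbalanced, by at most one. -/
structure IsTrailSystem (m P r : ℕ) (H : ℕ → ℕ → ℕ) (p q L tl hd : ℕ → ℕ) : Prop where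
  label_lt : ∀ e < m, L e < m
  treated : ∀ l < r, ∑ c ∈ Finset.range m, |trailDiff m p q L (H l) c| ≤ 1
  untreated : ∀ l < P, r ≤ l → ∀ c < m,
    trailDiff m p q L (H l) c = (H l (tl c) : ℤ) - H l (hd c)

theorem trailDiff_reverse {m : ℕ} {p q p' q' L : ℕ → ℕ} {c : ℕ}
    (hp : ∀ e < m, p' e = if L e = c then q e else p e)
    (hq : ∀ e < m, q' e = if L e = c then p e else q e) (δ : ℕ → ℕ) (d : ℕ) :
    trailDiff m p' q' L δ d = if d = c then -trailDiff m p q L δ d else trailDiff m p q L δ d := by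
  unfold trailDiff
  split_ifs with hd
  · subst hd
    rw [← Finset.sum_neg_distrib]
    refine Finset.sum_congr rfl fun e he => ?_
    rw [hp e (Finset.mem_range.1 he), hq e (Finset.mem_range.1 he)]
    split_ifs <;> ring
  · refine Finset.sum_congr rfl fun e he => ?_
    rw [hp e (Finset.mem_range.1 he), hq e (Finset.mem_range.1 he)]
    split_ifs with h₁ h₂
    · exact absurd (h₁.symm.trans h₂) hd
    · rfl
    · rfl

theorem trailDiff_merge {m : ℕ} {p q L L' : ℕ → ℕ} {c d : ℕ} (hcd : d ≠ c)
    (hL : ∀ e < m, L' e = if L e = c then d else L e) (δ : ℕ → ℕ) (x : ℕ) :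
    trailDiff m p q L' δ x = if x = c then 0 else if x = d then
      trailDiff m p q L δ d + trailDiff m p q L δ c else trailDiff m p q L δ x := by
  unfold trailDiff
  split_ifs with h₁ h₂
  · refine Finset.sum_eq_zero fun e he => ?_
    rw [hL e (Finset.mem_range.1 he)]
    grind
  · rw [← Finset.sum_add_distrib]
    refine Finset.sum_congr rfl fun e he => ?_
    rw [hL e (Finset.mem_range.1 he)]
    grind
  · refine Finset.sum_congr rfl fun e he => ?_
    rw [hL e (Finset.mem_range.1 he)]
    grind

theorem sum_trailDiff {m : ℕ} {p q L : ℕ → ℕ} (hL : ∀ e < m, L e < m) (δ : ℕ → ℕ) :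
    ∑ c ∈ Finset.range m, trailDiff m p q L δ c =
      ∑ e ∈ Finset.range m, ((δ (p e) : ℤ) - δ (q e)) := by
  unfold trailDiff
  rw [Finset.sum_comm]
  refine Finset.sum_congr rfl fun e he => ?_
  rw [Finset.sum_ite_eq, if_pos (Finset.mem_range.2 (hL e (Finset.mem_range.1 he)))]

namespace IsTrailSystem

variable {m P r : ℕ} {H : ℕ → ℕ → ℕ} {p q L tl hd : ℕ → ℕ}

theorem reverse (h : IsTrailSystem m P r H p q L tl hd) {c : ℕ} {p' q' tl' hd' : ℕ → ℕ}
    (hp : ∀ e < m, p' e = if L e = c then q e else p e)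
    (hq : ∀ e < m, q' e = if L e = c then p e else q e)
    (htl : ∀ x, tl' x = if x = c then hd x else tl x)
    (hhd : ∀ x, hd' x = if x = c then tl x else hd x) :
    IsTrailSystem m P r H p' q' L tl' hd' where
  label_lt := h.label_lt
  treated l hl := by
    refine le_of_eq_of_le (Finset.sum_congr rfl fun d _ => ?_) (h.treated l hl)
    rw [trailDiff_reverse hp hq]
    split_ifs <;> simp
  untreated l hl hr d hd := by
    rw [trailDiff_reverse hp hq, h.untreated l hl hr d hd, htl, hhd]
    split_ifs <;> ring

theorem merge (h : IsTrailSystem m P r H p q L tl hd) {c d : ℕ} (hc : c < m) (hd' : d < m)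
    (hdc : d ≠ c) (hH : ∀ l < P, r ≤ l → H l (hd d) = H l (tl c)) {L' hd₂ : ℕ → ℕ}
    (hL : ∀ e < m, L' e = if L e = c then d else L e)
    (hhd : ∀ x, hd₂ x = if x = c then tl x else if x = d then hd c else hd x) :
    IsTrailSystem m P r H p q L' tl hd₂ where
  label_lt e he := by
    rw [hL e he]
    split_ifs
    · exact hd'
    · exact h.label_lt e he
  treated l hl := by
    refine le_trans ?_ (h.treated l hl)
    have hsub : ({c, d} : Finset ℕ) ⊆ Finset.range m := by
      intro x hx
      simp only [Finset.mem_insert, Finset.mem_singleton] at hx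
      rcases hx with rfl | rfl <;> simpa
    rw [← Finset.sum_sdiff hsub, ← Finset.sum_sdiff hsub, Finset.sum_pair hdc.symm,
      Finset.sum_pair hdc.symm]
    refine add_le_add (le_of_eq (Finset.sum_congr rfl fun x hx => ?_)) ?_
    · simp only [Finset.mem_sdiff, Finset.mem_insert, Finset.mem_singleton, not_or] at hx
      rw [trailDiff_merge hdc hL, if_neg hx.2.1, if_neg hx.2.2]
    · rw [trailDiff_merge hdc hL, trailDiff_merge hdc hL, if_pos rfl, if_neg hdc, if_pos rfl,
        abs_zero, zero_add, add_comm |trailDiff m p q L (H l) c|]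
      exact abs_add_le _ _
  untreated l hl hr x hx := by
    rw [trailDiff_merge hdc hL, hhd, h.untreated l hl hr x hx, h.untreated l hl hr d hd',
      h.untreated l hl hr c hc]
    split_ifs with h₁ h₂
    · simp
    · subst h₂
      rw [hH l hl hr]
      ring
    · rfl

/-- The next group becomes a treated one when at most one trail has exactly one end in it. -/
theorem treat (h : IsTrailSystem m P r H p q L tl hd) (hr : r < P) (d : ℕ)
    (hd₁ : H r (tl d) ≤ 1) (hd₂ : H r (hd d) ≤ 1)
    (hH : ∀ c < m, c ≠ d → H r (tl c) = H r (hd c)) :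
    IsTrailSystem m P (r + 1) H p q L tl hd where
  label_lt := h.label_lt
  treated l hl := by
    rcases Nat.lt_succ_iff_lt_or_eq.1 hl with hl | rfl
    · exact h.treated l hl
    · calc ∑ c ∈ Finset.range m, |trailDiff m p q L (H l) c|
          ≤ ∑ c ∈ Finset.range m, if c = d then 1 else 0 := by
            refine Finset.sum_le_sum fun c hc => ?_
            rw [h.untreated l hr le_rfl c (Finset.mem_range.1 hc)]
            split_ifs with hcd
            · subst hcd
              rw [abs_le]
              omega
            · rw [hH c (Finset.mem_range.1 hc) hcd]
              simp
        _ ≤ 1 := by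
            rw [Finset.sum_ite_eq']
            split_ifs <;> norm_num
  untreated l hl hr' := h.untreated l hl (by omega)

theorem abs_sum_le_one (h : IsTrailSystem m P r H p q L tl hd) {l : ℕ} (hl : l < r) :
    |∑ e ∈ Finset.range m, ((H l (p e) : ℤ) - H l (q e))| ≤ 1 := by
  rw [← sum_trailDiff h.label_lt]
  exact (Finset.abs_sum_le_sum_abs _ _).trans (h.treated l hl)

end IsTrailSystem

/-! ### The potential of a colouring -/

/-- The number of items `e < m` whose copy of colour `c` goes to the group with indicator
function `δ`; the table `T` has the agent that gets the copy `c` of `e` in the place `T e c`. -/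
def colourCount (m : ℕ) (δ : ℕ → ℕ) (T : ℕ → ℕ → ℕ) (c : ℕ) : ℕ :=
  ∑ e ∈ Finset.range m, δ (T e c)

/-- The sum of the squares of the counts of all colours `c < n` in all groups `k < K`. -/
def potential (n m K : ℕ) (G : ℕ → ℕ → ℕ) (T : ℕ → ℕ → ℕ) : ℕ :=
  ∑ k ∈ Finset.range K, ∑ c ∈ Finset.range n, colourCount m (G k) T c ^ 2

theorem potential_le {n m K : ℕ} {G : ℕ → ℕ → ℕ} (hG : ∀ k i, G k i ≤ 1) (T : ℕ → ℕ → ℕ) :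
    potential n m K G T ≤ K * (n * m ^ 2) := by
  refine (Finset.sum_le_card_nsmul _ _ (n * m ^ 2) fun k _ => ?_).trans (by simp)
  refine (Finset.sum_le_card_nsmul _ _ (m ^ 2) fun c _ => ?_).trans (by simp)
  refine Nat.pow_le_pow_left ((Finset.sum_le_card_nsmul _ _ 1 fun e _ => hG _ _).trans ?_) 2
  simp

/-- `T'` arises from `T` when some items exchange the agents of their colours `a` and `b`. -/
def IsExchange (a b : ℕ) (T T' : ℕ → ℕ → ℕ) : Prop :=
  (∀ e c, c ≠ a → c ≠ b → T' e c = T e c) ∧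
    ∀ e, (T' e a = T e a ∧ T' e b = T e b) ∨ (T' e a = T e b ∧ T' e b = T e a)

theorem IsExchange.refl (a b : ℕ) (T : ℕ → ℕ → ℕ) : IsExchange a b T T :=
  ⟨fun _ _ _ _ => rfl, fun _ => .inl ⟨rfl, rfl⟩⟩

theorem IsExchange.trans {a b : ℕ} {T T' T'' : ℕ → ℕ → ℕ} (h : IsExchange a b T T')
    (h' : IsExchange a b T' T'') : IsExchange a b T T'' := by
  refine ⟨fun e c ha hb => (h'.1 e c ha hb).trans (h.1 e c ha hb), fun e => ?_⟩
  have h₁ := h.2 e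
  have h₂ := h'.2 e
  grind

theorem IsExchange.add_eq {a b : ℕ} {T T' : ℕ → ℕ → ℕ} (h : IsExchange a b T T') (f : ℕ → ℕ)
    (e : ℕ) : f (T' e a) + f (T' e b) = f (T e a) + f (T e b) := by
  rcases h.2 e with ⟨h₁, h₂⟩ | ⟨h₁, h₂⟩ <;> rw [h₁, h₂]
  exact add_comm _ _

theorem sum_range_eq_add_add {n a b : ℕ} (ha : a < n) (hb : b < n) (hab : a ≠ b) (f : ℕ → ℕ) :
    ∑ c ∈ Finset.range n, f c =
      f a + f b + ∑ c ∈ ((Finset.range n).erase a).erase b, f c := by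
  rw [add_assoc, Finset.add_sum_erase _ _ (Finset.mem_erase.2 ⟨hab.symm, Finset.mem_range.2 hb⟩),
    Finset.add_sum_erase _ _ (Finset.mem_range.2 ha)]

theorem IsExchange.sum_eq {a b n : ℕ} {T T' : ℕ → ℕ → ℕ} (h : IsExchange a b T T') (ha : a < n)
    (hb : b < n) (hab : a ≠ b) (f : ℕ → ℕ) (e : ℕ) :
    ∑ c ∈ Finset.range n, f (T' e c) = ∑ c ∈ Finset.range n, f (T e c) := by
  rw [sum_range_eq_add_add ha hb hab, sum_range_eq_add_add ha hb hab, h.add_eq f e]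
  congr 1
  refine Finset.sum_congr rfl fun c hc => ?_
  simp only [Finset.mem_erase] at hc
  rw [h.1 e c hc.2.1 hc.1]

/-- Among the pairs of naturals with a given sum, the balanced ones have the least squares. -/
theorem sq_add_sq_le_of_balanced {x y x' y' : ℕ} (h₁ : x' + y' = x + y) (h₂ : x' ≤ y' + 1)
    (h₃ : y' ≤ x' + 1) :
    x' ^ 2 + y' ^ 2 ≤ x ^ 2 + y ^ 2 ∧ (y + 2 ≤ x → x' ^ 2 + y' ^ 2 < x ^ 2 + y ^ 2) := by
  zify at *
  have e₁ : (2 : ℤ) * (x ^ 2 + y ^ 2) = (x' + y') ^ 2 + (x - y) ^ 2 := by rw [h₁]; ring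
  have e₂ : (2 : ℤ) * (x' ^ 2 + y' ^ 2) = (x' + y') ^ 2 + (x' - y') ^ 2 := by ring
  have e₃ : ((x' : ℤ) - y') ^ 2 ≤ 1 := by
    rw [sq_le_one_iff_abs_le_one, abs_le]
    constructor <;> linarith
  refine ⟨?_, fun h₄ => ?_⟩
  · by_cases hxy : (x : ℤ) = y
    · obtain ⟨hx, hy⟩ : (x' : ℤ) = x ∧ (y' : ℤ) = y := by omega
      rw [hx, hy]
    · have : 0 < ((x : ℤ) - y) ^ 2 := by
        have := sub_ne_zero.2 hxy
        positivity
      have : (1 : ℤ) ≤ ((x : ℤ) - y) ^ 2 := this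
      linarith
  · have : (2 : ℤ) ^ 2 ≤ ((x : ℤ) - y) ^ 2 := pow_le_pow_left₀ (by norm_num) (by linarith) 2
    linarith

/-- Balancing two colours that some group tells apart by at least two lowers the potential. -/
theorem IsExchange.potential_lt {a b n m K : ℕ} {G : ℕ → ℕ → ℕ} {T T' : ℕ → ℕ → ℕ}
    (h : IsExchange a b T T') (ha : a < n) (hb : b < n) {k : ℕ} (hk : k < K)
    (hT : colourCount m (G k) T b + 2 ≤ colourCount m (G k) T a)
    (hT' : ∀ k < K, colourCount m (G k) T' a ≤ colourCount m (G k) T' b + 1 ∧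
      colourCount m (G k) T' b ≤ colourCount m (G k) T' a + 1) :
    potential n m K G T' < potential n m K G T := by
  have hab : a ≠ b := by rintro rfl; omega
  have hsum : ∀ k, colourCount m (G k) T' a + colourCount m (G k) T' b =
      colourCount m (G k) T a + colourCount m (G k) T b := by
    intro k
    simp only [colourCount, ← Finset.sum_add_distrib]
    exact Finset.sum_congr rfl fun e _ => h.add_eq _ e
  have hrest : ∀ k, ∑ c ∈ ((Finset.range n).erase a).erase b, colourCount m (G k) T' c ^ 2 =
      ∑ c ∈ ((Finset.range n).erase a).erase b, colourCount m (G k) T c ^ 2 := by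
    intro k
    refine Finset.sum_congr rfl fun c hc => ?_
    simp only [Finset.mem_erase] at hc
    congr 1
    exact Finset.sum_congr rfl fun e _ => by rw [h.1 e c hc.2.1 hc.1]
  have key := @sq_add_sq_le_of_balanced
  refine Finset.sum_lt_sum (fun l hl => ?_) ⟨k, Finset.mem_range.2 hk, ?_⟩
  · rw [sum_range_eq_add_add ha hb hab, sum_range_eq_add_add ha hb hab, hrest]
    have hb' := hT' l (Finset.mem_range.1 hl)
    exact Nat.add_le_add_right (key (hsum l) hb'.1 hb'.2).1 _
  · rw [sum_range_eq_add_add ha hb hab, sum_range_eq_add_add ha hb hab, hrest]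
    have hb' := hT' k hk
    exact Nat.add_lt_add_right ((key (hsum k) hb'.1 hb'.2).2 hT) _

/-! ### The program that balances two colours -/

/-- The number of agents. -/
abbrev agentsExpr : Expr := .read 0 (.const 0) (.const 0)

/-- The number of items. -/
abbrev itemsExpr : Expr := .read 0 (.const 1) (.const 0)

/-- The number of groups, including the group of all agents. -/
abbrev groupsExpr : Expr := .add (.read 0 (.const 2) (.const 0)) (.const 1)

/-- Reverses the trail `c` (variable `34`): its items exchange the colours `a` and `b`, which are
the variables `25` and `26`. -/
def reverseTrail : Cmd :=
  .seq (.forBelow 38 itemsExpr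
    (.branch (.dist (.read 8 (.var 38) (.const 0)) (.var 34)) .skip
      (.seq (.set 39 (.read 4 (.var 38) (.var 25)))
        (.seq (.assign 4 (.var 38) (.var 25) (.read 4 (.var 38) (.var 26)))
          (.assign 4 (.var 38) (.var 26) (.var 39))))))
    (.seq (.set 39 (.read 6 (.var 34) (.const 0)))
      (.seq (.assign 6 (.var 34) (.const 0) (.read 7 (.var 34) (.const 0)))
        (.assign 7 (.var 34) (.const 0) (.var 39))))

theorem wp_reverseTrail {N m a b c : ℕ} {s : Store} (hm : s 0 1 0 = m) (hN : m ≤ N)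
    (ha : s 25 0 0 = a) (hb : s 26 0 0 = b) (hc : s 34 0 0 = c) :
    Wp N reverseTrail (fun s' =>
      (∀ e x, s' 4 e x = if e < m ∧ s 8 e 0 = c then
        (if x = b then s 4 e a else if x = a then s 4 e b else s 4 e x) else s 4 e x) ∧
      (∀ x, s' 6 x 0 = if x = c then s 7 x 0 else s 6 x 0) ∧
      ∀ x, s' 7 x 0 = if x = c then s 6 x 0 else s 7 x 0) s := by
  refine wp_seq ((wp_forBelow (h := m) (fun i s' => ∀ e x, s' 4 e x =
      if e < i ∧ s 8 e 0 = c then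
        (if x = b then s 4 e a else if x = a then s 4 e b else s 4 e x) else s 4 e x)
    rfl hN ?_ ?_ ?_ ?_).mono ?_)
  · intro s' hf
    simp [Expr.eval, hf 0 rfl, hm]
  · intro i s' y h
    simpa using h
  · simp
  · intro i s' hi hf hv h
    have h8 := hf 8 rfl
    have h25 : s' 25 0 0 = a := by rw [hf 25 rfl, ha]
    have h26 : s' 26 0 0 = b := by rw [hf 26 rfl, hb]
    have h34 : s' 34 0 0 = c := by rw [hf 34 rfl, hc]
    refine wp_branch (fun hne => wp_skip ?_) fun heq => ?_
    · rw [ne_eq, Expr.eval_dist_eq_zero] at hne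
      simp only [Expr.eval, hv, h8, h34] at hne
      intro e x
      rw [h e x]
      grind
    · rw [Expr.eval_dist_eq_zero] at heq
      simp only [Expr.eval, hv, h8, h34] at heq
      refine wp_seq (wp_assign (wp_seq (wp_assign (wp_assign ?_))))
      intro e x
      simp [Expr.eval, Store.write_apply, h25, h26, hv, h]
      grind
  · intro s' hf h
    have h34 : s' 34 0 0 = c := by rw [hf 34 rfl, hc]
    refine wp_seq (wp_assign (wp_seq (wp_assign (wp_assign ⟨?_, ?_, ?_⟩))))
    · simpa using h
    · intro x
      simp [Expr.eval, Store.write_apply, h34, hf 7 rfl, hf 6 rfl]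
      grind
    · intro x
      simp [Expr.eval, Store.write_apply, h34, hf 7 rfl, hf 6 rfl]
      grind

/-- Appends the trail `c` (variable `34`) to the trail `d` (variable `33` holds `d + 1`). The trail
`c` is left without items and with equal ends, so that it does no harm. -/
def mergeTrail : Cmd :=
  .seq (.assign 7 (.sub (.var 33) (.const 1)) (.const 0) (.read 7 (.var 34) (.const 0)))
    (.seq (.assign 7 (.var 34) (.const 0) (.read 6 (.var 34) (.const 0)))
      (.seq (.forBelow 40 itemsExpr
        (.branch (.dist (.read 8 (.var 40) (.const 0)) (.var 34)) .skip
          (.assign 8 (.var 40) (.const 0) (.sub (.var 33) (.const 1)))))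
        (.set 33 (.const 0))))

theorem wp_mergeTrail {N m c d : ℕ} {s : Store} (hm : s 0 1 0 = m) (hN : m ≤ N)
    (hc : s 34 0 0 = c) (hd : s 33 0 0 = d + 1) :
    Wp N mergeTrail (fun s' =>
      (∀ e < m, s' 8 e 0 = if s 8 e 0 = c then d else s 8 e 0) ∧
      (∀ x, s' 7 x 0 = if x = c then s 6 x 0 else if x = d then s 7 c 0 else s 7 x 0) ∧
      s' 33 0 0 = 0) s := by
  refine wp_seq (wp_assign (wp_seq (wp_assign (wp_seq ((wp_forBelow (h := m) (fun i s' =>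
    ∀ e, s' 8 e 0 = if e < i ∧ s 8 e 0 = c then d else s 8 e 0)
    rfl hN ?_ ?_ ?_ ?_).mono ?_)))))
  · intro s' hf
    simp [Expr.eval, hf 0 rfl, hm]
  · intro i s' y h
    simpa using h
  · simp
  · intro i s' hi hf hv h
    have h34 : s' 34 0 0 = c := by simp [hf 34 rfl, hc]
    have h33 : s' 33 0 0 = d + 1 := by simp [hf 33 rfl, hd]
    refine wp_branch (fun hne => wp_skip ?_) fun heq => ?_
    · rw [ne_eq, Expr.eval_dist_eq_zero] at hne
      simp only [Expr.eval, hv, h34, h] at hne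
      intro e
      rw [h e]
      grind
    · rw [Expr.eval_dist_eq_zero] at heq
      simp only [Expr.eval, hv, h34, h] at heq
      refine wp_assign ?_
      intro e
      simp [Expr.eval, Store.write_apply, h33, hv, h]
      grind
  · intro s' hf h
    refine wp_assign ⟨fun e he => ?_, fun x => ?_, ?_⟩
    · simp [h, he]
    · simp [hf 7 rfl, Store.write_apply, Expr.eval, hc, hd]
      grind
    · simp [Expr.eval]

/-- The groups with the indicator functions `H 0, …, H (P - 1)` are listed such that each of them
is contained in or disjoint from every later one. -/
def IsNested (P : ℕ) (H : ℕ → ℕ → ℕ) : Prop :=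
  ∀ p q, p ≤ q → q < P → (∀ x, H p x = 1 → H q x = 1) ∨ ∀ x, H p x = 1 → H q x = 0

/-- Treats the trail `c` (variable `34`) in the group `k` (variable `32`). If `c` has just one end
in the group, it is joined, after a reversal if need be, to the waiting trail `d` of this kind
(variable `33` holds `d + 1`, or `0` if there is none), or else becomes the waiting trail. -/
def joinTrail : Cmd :=
  .seq (.set 35 (.read 2 (.var 32) (.read 6 (.var 34) (.const 0))))
    (.seq (.set 36 (.read 2 (.var 32) (.read 7 (.var 34) (.const 0))))
      (.branch (.dist (.var 35) (.var 36))
        (.seq (.branch (.var 33) (.set 37 (.var 36)) (.set 37 (.var 35)))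
          (.seq (.branch (.var 37) reverseTrail .skip)
            (.branch (.var 33) mergeTrail (.set 33 (.add (.var 34) (.const 1))))))
        .skip))

/-- The state of the balancing of the colours `a` and `b` when the first `r` groups and, for the
group `r`, the first `i` trails have been treated. The initial table is `T`. Of these trails at
most the waiting one has exactly one end in the group `r`, namely its head. -/
structure IsBalancing (m P r i a b : ℕ) (H T : ℕ → ℕ → ℕ) (s : Store) : Prop where
  isExchange : IsExchange a b T (s 4)
  isTrailSystem : IsTrailSystem m P r H (fun e => s 4 e a) (fun e => s 4 e b) (fun e => s 8 e 0)
    (fun c => s 6 c 0) fun c => s 7 c 0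
  settled : ∀ c < i, c + 1 ≠ s 33 0 0 → H r (s 6 c 0) = H r (s 7 c 0)
  waiting : ∀ d, s 33 0 0 = d + 1 → d < i ∧ H r (s 6 d 0) = 0 ∧ H r (s 7 d 0) = 1

theorem IsBalancing.congr {m P r i a b : ℕ} {H T : ℕ → ℕ → ℕ} {s s' : Store}
    (h : IsBalancing m P r i a b H T s) (h4 : s' 4 = s 4) (h6 : s' 6 = s 6) (h7 : s' 7 = s 7)
    (h8 : s' 8 = s 8) (h33 : s' 33 = s 33) : IsBalancing m P r i a b H T s' := by
  refine ⟨?_, ?_, ?_, ?_⟩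
  · rw [h4]; exact h.1
  · rw [h4, h6, h7, h8]; exact h.2
  · rw [h6, h7, h33]; exact h.3
  · rw [h6, h7, h33]; exact h.4

theorem wp_joinTrail {N m P r i a b : ℕ} {H T : ℕ → ℕ → ℕ} {s : Store} (hm : s 0 1 0 = m)
    (hN : m ≤ N) (ha : s 25 0 0 = a) (hb : s 26 0 0 = b) (hab : a ≠ b) (hi : s 34 0 0 = i)
    (him : i < m) (hH : s 2 (s 32 0 0) = H r) (hH1 : ∀ x, H r x ≤ 1)
    (hnest : IsNested P H) (h : IsBalancing m P r i a b H T s) :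
    Wp N joinTrail (IsBalancing m P r (i + 1) a b H T) s := by
  refine wp_seq (wp_assign (wp_seq (wp_assign (wp_branch (fun hne => ?_) fun heq => ?_))))
  · rw [ne_eq, Expr.eval_dist_eq_zero] at hne
    simp [Expr.eval, hi, hH] at hne
    have hx := hH1 (s 6 i 0)
    have hy := hH1 (s 7 i 0)
    -- the direction that the trail `i` must have
    let K : Store → Prop := fun s' => IsBalancing m P r i a b H T s' ∧
      (s' 33 0 0 = 0 → H r (s' 6 i 0) = 0 ∧ H r (s' 7 i 0) = 1) ∧
      (s' 33 0 0 ≠ 0 → H r (s' 6 i 0) = 1 ∧ H r (s' 7 i 0) = 0)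
    -- a trail with the right direction is merged with the waiting one, or waits itself
    have hfin : ∀ s', K s' → s' 0 1 0 = m → s' 34 0 0 = i →
        Wp N (.branch (.var 33) mergeTrail (.set 33 (.add (.var 34) (.const 1))))
          (IsBalancing m P r (i + 1) a b H T) s' := by
      rintro s' ⟨hB, h0, h1⟩ hm' hi'
      refine wp_branch (fun hne => ?_) fun heq => ?_
      · simp only [Expr.eval] at hne
        obtain ⟨d, hd⟩ := Nat.exists_eq_succ_of_ne_zero hne
        obtain ⟨hdi, hd0, hd1⟩ := hB.waiting d hd
        obtain ⟨hi1, hi0⟩ := h1 hne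
        refine (wp_mergeTrail hm' hN hi' hd).mono fun s'' hf ⟨h8, h7, h33⟩ => ?_
        have h4 := hf 4 rfl
        have h6 := hf 6 rfl
        refine ⟨?_, ?_, ?_, ?_⟩
        · rw [h4]
          exact hB.1
        · rw [h4, h6]
          refine hB.isTrailSystem.merge him (hdi.trans him) hdi.ne (fun l hl hrl => ?_) h8
            fun x => ?_
          · -- both ends lie in the group `r`, so a group at `l ≥ r` does not separate them
            rcases hnest r l hrl hl with hsub | hdis
            · rw [hsub _ hd1, hsub _ hi1]
            · rw [hdis _ hd1, hdis _ hi1]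
          · exact h7 x
        · intro c hc _
          rw [h6, h7]
          split_ifs with hci hcd
          · rfl
          · rw [hcd, hd0, hi0]
          · exact hB.settled c (by omega) (by rw [hd]; omega)
        · intro d' hd'
          omega
      · simp only [Expr.eval] at heq
        obtain ⟨hi0, hi1⟩ := h0 heq
        refine wp_assign ⟨?_, ?_, ?_, ?_⟩
        · simpa using hB.1
        · simpa using hB.2
        · intro c hc hne
          simp [Expr.eval, hi'] at hne
          simpa using hB.settled c (by omega) (by omega)
        · intro d hd
          simp [Expr.eval, hi'] at hd
          subst hd
          simp [hi0, hi1]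
    refine wp_seq (Wp.mono (Q := fun s' => s' 37 0 0 = if s 33 0 0 = 0 then H r (s 6 i 0)
      else H r (s 7 i 0)) ?_ fun s₁ hf₁ hz => wp_seq (Wp.mono (Q := K) ?_
        fun s₂ hf₂ hK => hfin s₂ hK ?_ ?_))
    · refine wp_branch (fun hne => wp_assign ?_) fun heq => wp_assign ?_
      · simp only [Expr.eval] at hne
        simp [Expr.eval, hH, hi] at hne ⊢
        simp [hne]
      · simp [Expr.eval] at heq
        simp [Expr.eval, hH, hi, heq]
    · have hs : ∀ a, a ≠ 35 → a ≠ 36 → a ≠ 37 → s₁ a = s a := by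
        intro x h35 h36 h37
        rw [hf₁ x (by simp [Cmd.writes, h37])]
        simp [h35, h36]
      have h6 := hs 6 (by decide) (by decide) (by decide)
      have h7 := hs 7 (by decide) (by decide) (by decide)
      have h33 := hs 33 (by decide) (by decide) (by decide)
      have hB : IsBalancing m P r i a b H T s₁ :=
        h.congr (hs 4 (by decide) (by decide) (by decide)) h6 h7
          (hs 8 (by decide) (by decide) (by decide)) h33
      refine wp_branch (fun hne => ?_) fun heq => wp_skip ?_
      · simp only [Expr.eval, hz] at hne
        refine (wp_reverseTrail (a := a) (b := b) (c := i) ?_ hN ?_ ?_ ?_).mono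
          fun s₂ hf₂ ⟨h4', h6', h7'⟩ => ?_
        · rw [hs 0 (by decide) (by decide) (by decide), hm]
        · rw [hs 25 (by decide) (by decide) (by decide), ha]
        · rw [hs 26 (by decide) (by decide) (by decide), hb]
        · rw [hs 34 (by decide) (by decide) (by decide), hi]
        · have h33' := hf₂ 33 rfl
          have h8' := hf₂ 8 rfl
          refine ⟨⟨hB.1.trans ⟨fun e c hca hcb => ?_, fun e => ?_⟩, ?_, ?_, ?_⟩, ?_, ?_⟩
          · rw [h4']
            simp [hca, hcb]
          · rw [h4', h4']
            simp [hab]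
            grind
          · rw [h8']
            refine hB.isTrailSystem.reverse (c := i) (fun e he => ?_) (fun e he => ?_) h6' h7'
            · rw [h4']
              simp [hab, he]
            · rw [h4']
              simp [he]
          · intro c hc
            rw [h33', h6', h7', if_neg hc.ne, if_neg hc.ne]
            exact hB.settled c hc
          · intro d hd
            rw [h33'] at hd
            have := hB.waiting d hd
            rw [h6', h7', if_neg this.1.ne, if_neg this.1.ne]
            exact this
          · intro h0
            rw [h33', h33] at h0
            rw [h6', h7', if_pos rfl, if_pos rfl, h6, h7]
            rw [if_pos h0] at hne
            omega
          · intro h0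
            rw [h33', h33] at h0
            rw [h6', h7', if_pos rfl, if_pos rfl, h6, h7]
            rw [if_neg h0] at hne
            omega
      · simp only [Expr.eval, hz] at heq
        refine ⟨hB, fun h0 => ?_, fun h0 => ?_⟩
        · rw [h33] at h0
          rw [if_pos h0] at heq
          rw [h6, h7]
          omega
        · rw [h33] at h0
          rw [if_neg h0] at heq
          rw [h6, h7]
          omega
    · rw [hf₂ 0 rfl, hf₁ 0 rfl]
      simpa using hm
    · rw [hf₂ 34 rfl, hf₁ 34 rfl]
      simpa using hi
  · rw [Expr.eval_dist_eq_zero] at heq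
    simp [Expr.eval, hi, hH] at heq
    have hB : IsBalancing m P r i a b H T
        ((s.write 35 0 0 (H r (s 6 i 0))).write 36 0 0 (H r (s 7 i 0))) :=
      h.congr (by simp) (by simp) (by simp) (by simp) (by simp)
    simp only [Expr.eval, hi, hH, Store.write_of_ne _ (show 7 ≠ 35 by decide),
      Store.write_of_ne _ (show 34 ≠ 35 by decide), Store.write_of_ne _ (show 2 ≠ 35 by decide),
      Store.write_of_ne _ (show 32 ≠ 35 by decide)]
    refine wp_skip ⟨hB.1, hB.2, fun c hc hne => ?_, fun d hd => ?_⟩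
    · rcases Nat.lt_succ_iff_lt_or_eq.1 hc with hc | rfl
      · exact hB.settled c hc hne
      · simpa using heq
    · obtain ⟨h₁, h₂⟩ := hB.waiting d hd
      exact ⟨by omega, h₂⟩

/-- The memory after the preparations: the groups `k ≤ g` (the group `g` has all agents) have the
indicator functions `G k`, and are listed in the order `ord 0, …, ord (P - 1)`, in which each
group is contained in or disjoint from every later one. All bounds of loops are at most `N`. -/
structure IsPrepared (N n m g P : ℕ) (G : ℕ → ℕ → ℕ) (ord : ℕ → ℕ) (s : Store) : Prop where
  agents : s 0 0 0 = n
  items : s 0 1 0 = m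
  groups : s 0 2 0 = g
  indicator : s 2 = G
  order : ∀ l, s 5 l 0 = ord l
  length : s 11 0 0 = P
  agents_le : n ≤ N
  items_le : m ≤ N
  groups_le : g + 1 ≤ N
  length_le : P ≤ N
  indicator_le : ∀ k x, G k x ≤ 1
  exists_order : ∀ k ≤ g, ∃ l < P, ord l = k
  nested : IsNested P fun l => G (ord l)

theorem IsPrepared.congr {N n m g P : ℕ} {G : ℕ → ℕ → ℕ} {ord : ℕ → ℕ} {s s' : Store}
    (h : IsPrepared N n m g P G ord s) (h0 : s' 0 = s 0) (h2 : s' 2 = s 2) (h5 : s' 5 = s 5)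
    (h11 : s' 11 = s 11) : IsPrepared N n m g P G ord s' where
  __ := h
  agents := h0 ▸ h.agents
  items := h0 ▸ h.items
  groups := h0 ▸ h.groups
  indicator := h2 ▸ h.indicator
  order := h5 ▸ h.order
  length := h11 ▸ h.length

/-- At first every item is a trail of its own. -/
theorem isTrailSystem_id (m P : ℕ) (H : ℕ → ℕ → ℕ) (p q : ℕ → ℕ) {L tl hd : ℕ → ℕ}
    (hL : ∀ e < m, L e = e) (htl : ∀ e < m, tl e = p e) (hhd : ∀ e < m, hd e = q e) :
    IsTrailSystem m P 0 H p q L tl hd where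
  label_lt e he := (hL e he).symm ▸ he
  treated l hl := absurd hl (Nat.not_lt_zero l)
  untreated l _ _ c hc := by
    unfold trailDiff
    rw [Finset.sum_eq_single_of_mem c (Finset.mem_range.2 hc), if_pos (hL c hc), htl c hc,
      hhd c hc]
    intro e he hec
    rw [hL e (Finset.mem_range.1 he), if_neg hec]

/-- Balances the colours `a` and `b` (variables `25` and `26`). -/
def balanceColours : Cmd :=
  .seq (.forBelow 30 itemsExpr
    (.seq (.assign 8 (.var 30) (.const 0) (.var 30))
      (.seq (.assign 6 (.var 30) (.const 0) (.read 4 (.var 30) (.var 25)))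
        (.assign 7 (.var 30) (.const 0) (.read 4 (.var 30) (.var 26))))))
    (.forBelow 31 (.var 11)
      (.seq (.set 32 (.read 5 (.var 31) (.const 0)))
        (.seq (.set 33 (.const 0)) (.forBelow 34 itemsExpr joinTrail))))

theorem wp_balanceColours {N n m g P a b : ℕ} {G : ℕ → ℕ → ℕ} {ord : ℕ → ℕ} {s : Store}
    (h : IsPrepared N n m g P G ord s) (ha : s 25 0 0 = a) (hb : s 26 0 0 = b) (hab : a ≠ b) :
    Wp N balanceColours (fun s' => IsExchange a b (s 4) (s' 4) ∧
      ∀ k ≤ g, colourCount m (G k) (s' 4) a ≤ colourCount m (G k) (s' 4) b + 1 ∧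
        colourCount m (G k) (s' 4) b ≤ colourCount m (G k) (s' 4) a + 1) s := by
  let H : ℕ → ℕ → ℕ := fun l => G (ord l)
  refine wp_seq ((wp_forBelow (h := m) (fun i s' => ∀ e < i,
    s' 8 e 0 = e ∧ s' 6 e 0 = s 4 e a ∧ s' 7 e 0 = s 4 e b) rfl h.items_le ?_ ?_ ?_ ?_).mono ?_)
  · intro s' hf
    simp [Expr.eval, hf 0 rfl, h.items]
  · intro i s' y h
    simpa using h
  · simp
  · intro i s' hi hf hv hI
    refine wp_seq (wp_assign (wp_seq (wp_assign (wp_assign ?_))))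
    intro e he
    have := hI e
    simp [Expr.eval, Store.write_apply, hv, hf 25 rfl, hf 26 rfl, ha, hb, hf 4 rfl]
    grind
  intro s₁ hf₁ hinit
  have h₁ : IsPrepared N n m g P G ord s₁ :=
    h.congr (hf₁ 0 rfl) (hf₁ 2 rfl) (hf₁ 5 rfl) (hf₁ 11 rfl)
  refine (wp_forBelow (h := P) (fun r s' => IsExchange a b (s 4) (s' 4) ∧
    IsTrailSystem m P r H (fun e => s' 4 e a) (fun e => s' 4 e b) (fun e => s' 8 e 0)
      (fun c => s' 6 c 0) fun c => s' 7 c 0) rfl h.length_le ?_ ?_ ?_ ?_).mono ?_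
  · intro s' hf
    simp [Expr.eval, hf 11 rfl, h₁.length]
  · intro i s' y h
    simpa using h
  · rw [hf₁ 4 rfl]
    exact ⟨.refl a b _, isTrailSystem_id m P H _ _ (fun e he => (hinit e he).1)
      (fun e he => (hinit e he).2.1) fun e he => (hinit e he).2.2⟩
  · rintro r s' hr hf hv ⟨hex, hts⟩
    have h' : IsPrepared N n m g P G ord s' := h₁.congr (hf 0 rfl) (hf 2 rfl) (hf 5 rfl) (hf 11 rfl)
    refine wp_seq (wp_assign (wp_seq (wp_assign ?_)))
    refine (wp_forBelow (h := m) (fun i s' => IsBalancing m P r i a b H (s 4) s')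
      rfl h.items_le ?_ ?_ ?_ ?_).mono ?_
    · intro s'' hf'
      simp [Expr.eval, hf' 0 rfl, h'.items]
    · intro i s'' y hB
      exact hB.congr (by simp) (by simp) (by simp) (by simp) (by simp)
    · exact ⟨by simpa using hex, by simpa using hts, fun c hc => absurd hc (Nat.not_lt_zero c),
        fun d hd => by simp [Expr.eval] at hd⟩
    · intro i s'' hi hf' hv' hB
      refine wp_joinTrail ?_ h.items_le ?_ ?_ hab hv' hi ?_ (h.indicator_le _) h.nested hB
      · simp [hf' 0 rfl, h'.items]
      · simp [hf' 25 rfl, hf 25 rfl, hf₁ 25 rfl, ha]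
      · simp [hf' 26 rfl, hf 26 rfl, hf₁ 26 rfl, hb]
      · simp [hf' 2 rfl, hf' 32 rfl, Expr.eval, hv, h'.indicator, h'.order, H]
    · intro s'' _ hB
      -- only the waiting trail has one end in the group; if there is none, any trail will do
      refine ⟨hB.1, hB.2.treat hr (s'' 33 0 0 - 1) (h.indicator_le _ _) (h.indicator_le _ _)
        fun c hc hne => hB.settled c hc ?_⟩
      omega
  · rintro s' - ⟨hex, hts⟩
    refine ⟨hex, fun k hk => ?_⟩
    obtain ⟨l, hl, rfl⟩ := h.exists_order k hk
    have := hts.abs_sum_le_one hl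
    rw [Finset.sum_sub_distrib, abs_le] at this
    simp only [colourCount]
    zify
    simp only [H] at this
    constructor <;> linarith

/-! ### The program that balances all colours -/

/-- Computes the counts of the colours `a` and `b` (variables `25` and `26`) in the group `k`
(variable `24`). -/
def countColours : Cmd :=
  .seq (.set 27 (.const 0)) (.seq (.set 28 (.const 0)) (.forBelow 29 itemsExpr
    (.seq (.set 27 (.add (.var 27) (.read 2 (.var 24) (.read 4 (.var 29) (.var 25)))))
      (.set 28 (.add (.var 28) (.read 2 (.var 24) (.read 4 (.var 29) (.var 26))))))))

theorem wp_countColours {N m k a b : ℕ} {s : Store} (hm : s 0 1 0 = m) (hN : m ≤ N)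
    (hk : s 24 0 0 = k) (ha : s 25 0 0 = a) (hb : s 26 0 0 = b) :
    Wp N countColours (fun s' => s' 27 0 0 = colourCount m (s 2 k) (s 4) a ∧
      s' 28 0 0 = colourCount m (s 2 k) (s 4) b) s := by
  refine wp_seq (wp_assign (wp_seq (wp_assign ?_)))
  refine wp_forBelow (h := m) (fun i s' => s' 27 0 0 = colourCount i (s 2 k) (s 4) a ∧
      s' 28 0 0 = colourCount i (s 2 k) (s 4) b) rfl hN ?_ ?_ ?_ ?_
  · intro s' hf
    simp [Expr.eval, hf 0 rfl, hm]
  · intro i s' y h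
    simpa using h
  · simp [colourCount, Expr.eval]
  · rintro i s' hi hf hv ⟨h₁, h₂⟩
    refine wp_seq (wp_assign (wp_assign ?_))
    simp [Expr.eval, hv, hf 25 rfl, hf 26 rfl, hf 24 rfl, hf 4 rfl, hf 2 rfl, ha, hb, hk, h₁, h₂,
      colourCount, Finset.sum_range_succ]

/-- In the table `T'` every item has the same agents, with multiplicities, as in `T`. -/
def IsShuffle (n : ℕ) (T T' : ℕ → ℕ → ℕ) : Prop :=
  ∀ (f : ℕ → ℕ) (e : ℕ), ∑ c ∈ Finset.range n, f (T' e c) = ∑ c ∈ Finset.range n, f (T e c)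

/-- The state of a sweep through the triples of a group `k` and two colours `a` and `b`, when the
triples in `D` have been inspected and the sweep began with the table `T`. Either (variable `23`
is zero) nothing has changed, for want of a reason in `D`, or the potential has dropped. -/
def IsSweep (n m g : ℕ) (G T : ℕ → ℕ → ℕ) (D : ℕ → ℕ → ℕ → Prop) (s : Store) : Prop :=
  IsShuffle n T (s 4) ∧
    ((s 23 0 0 = 0 ∧ s 4 = T ∧
        ∀ k a b, D k a b → colourCount m (G k) T a < colourCount m (G k) T b + 2) ∨
      (s 23 0 0 ≠ 0 ∧ potential n m (g + 1) G (s 4) < potential n m (g + 1) G T))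

theorem IsSweep.congr {n m g : ℕ} {G T : ℕ → ℕ → ℕ} {D D' : ℕ → ℕ → ℕ → Prop} {s s' : Store}
    (h : IsSweep n m g G T D s) (h4 : s' 4 = s 4) (h23 : s' 23 = s 23)
    (hD : ∀ k a b, D' k a b → D k a b) : IsSweep n m g G T D' s' := by
  unfold IsSweep
  rw [h4, h23]
  exact ⟨h.1, h.2.imp (fun h => ⟨h.1, h.2.1, fun k a b hk => h.2.2 k a b (hD k a b hk)⟩) id⟩

/-- Balances the colours `a` and `b` if the group `k` has at least two more copies of colour `a`
than of colour `b`. -/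
def inspectColours : Cmd :=
  .seq countColours (.branch (.sub (.sub (.var 27) (.var 28)) (.const 1))
    (.seq (.set 23 (.const 1)) balanceColours) .skip)

theorem wp_inspectColours {N n m g P k a b : ℕ} {G T : ℕ → ℕ → ℕ} {ord : ℕ → ℕ}
    {D : ℕ → ℕ → ℕ → Prop} {s : Store} (h : IsPrepared N n m g P G ord s) (hk : s 24 0 0 = k)
    (ha : s 25 0 0 = a) (hb : s 26 0 0 = b) (hkg : k ≤ g) (han : a < n) (hbn : b < n)
    (hs : IsSweep n m g G T D s) :
    Wp N inspectColours (IsSweep n m g G T fun k' a' b' => D k' a' b' ∨ k' = k ∧ a' = a ∧ b' = b)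
      s := by
  refine wp_seq ((wp_countColours h.items h.items_le hk ha hb).mono fun s₁ hf₁ ⟨h27, h28⟩ => ?_)
  rw [h.indicator] at h27 h28
  have hs₁ : IsSweep n m g G T D s₁ := hs.congr (hf₁ 4 rfl) (hf₁ 23 rfl) fun _ _ _ => id
  refine wp_branch (fun hne => ?_) fun heq => wp_skip ?_
  · simp only [Expr.eval, h27, h28] at hne
    have hgap : colourCount m (G k) (s 4) b + 2 ≤ colourCount m (G k) (s 4) a := by omega
    refine wp_seq (wp_assign ?_)
    refine (wp_balanceColours (a := a) (b := b) (h.congr ?_ ?_ ?_ ?_) ?_ ?_ ?_).mono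
      fun s' hf' ⟨hex, hbal⟩ => ?_
    · simp [hf₁ 0 rfl]
    · simp [hf₁ 2 rfl]
    · simp [hf₁ 5 rfl]
    · simp [hf₁ 11 rfl]
    · simp [hf₁ 25 rfl, ha]
    · simp [hf₁ 26 rfl, hb]
    · rintro rfl
      omega
    · have hab : a ≠ b := by
        rintro rfl
        omega
      simp only [Store.write_of_ne _ (show 4 ≠ 23 by decide), hf₁ 4 rfl] at hex
      have hlt := hex.potential_lt han hbn (Nat.lt_succ_of_le hkg) hgap
        fun k hk => hbal k (Nat.le_of_lt_succ hk)
      refine ⟨fun f e => (hex.sum_eq han hbn hab f e).trans (hs.1 f e), .inr ⟨?_, ?_⟩⟩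
      · simp [hf' 23 rfl, Expr.eval]
      · rcases hs.2 with ⟨-, h4, -⟩ | ⟨-, hlt'⟩
        · rwa [← h4]
        · exact hlt.trans hlt'
  · simp only [Expr.eval, h27, h28] at heq
    refine ⟨hs₁.1, hs₁.2.imp (fun ⟨h₁, h₂, h₃⟩ => ⟨h₁, h₂, ?_⟩) id⟩
    rintro k' a' b' (hD | ⟨rfl, rfl, rfl⟩)
    · exact h₃ k' a' b' hD
    · rw [← h₂, hf₁ 4 rfl]
      omega

/-- Sweeps through all triples of a group and two colours. -/
def sweepColours : Cmd :=
  .forBelow 24 groupsExpr (.forBelow 25 agentsExpr (.forBelow 26 agentsExpr inspectColours))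

theorem wp_sweepColours {N n m g P : ℕ} {G : ℕ → ℕ → ℕ} {ord : ℕ → ℕ} {s : Store}
    (h : IsPrepared N n m g P G ord s) (h23 : s 23 0 0 = 0) :
    Wp N sweepColours (IsSweep n m g G (s 4) fun k a b => k < g + 1 ∧ a < n ∧ b < n) s := by
  refine wp_forBelow (h := g + 1)
    (fun i => IsSweep n m g G (s 4) fun k a b => k < i ∧ a < n ∧ b < n)
    rfl h.groups_le ?_ ?_ ?_ ?_
  · intro s' hf
    simp [Expr.eval, hf 0 rfl, h.groups]
  · intro i s' y hs
    exact hs.congr (by simp) (by simp) fun _ _ _ => id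
  · exact ⟨fun _ _ => rfl, .inl ⟨h23, rfl, fun k a b hk => absurd hk.1 (Nat.not_lt_zero k)⟩⟩
  intro k s₁ hk hf₁ hv₁ hs₁
  have h₁ : IsPrepared N n m g P G ord s₁ :=
    h.congr (hf₁ 0 rfl) (hf₁ 2 rfl) (hf₁ 5 rfl) (hf₁ 11 rfl)
  refine (wp_forBelow (h := n) (fun i => IsSweep n m g G (s 4) fun k' a b =>
    (k' < k ∧ a < n ∧ b < n) ∨ k' = k ∧ a < i ∧ b < n) rfl h.agents_le ?_ ?_ ?_ ?_).mono ?_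
  · intro s' hf
    simp [Expr.eval, hf 0 rfl, h₁.agents]
  · intro i s' y hs
    exact hs.congr (by simp) (by simp) fun _ _ _ => id
  · exact hs₁.congr rfl rfl (by omega)
  · intro a s₂ ha hf₂ hv₂ hs₂
    have h₂ : IsPrepared N n m g P G ord s₂ :=
      h₁.congr (hf₂ 0 rfl) (hf₂ 2 rfl) (hf₂ 5 rfl) (hf₂ 11 rfl)
    refine (wp_forBelow (h := n) (fun i => IsSweep n m g G (s 4) fun k' a' b =>
      ((k' < k ∧ a' < n ∧ b < n) ∨ k' = k ∧ a' < a ∧ b < n) ∨ k' = k ∧ a' = a ∧ b < i)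
      rfl h.agents_le ?_ ?_ ?_ ?_).mono ?_
    · intro s' hf
      simp [Expr.eval, hf 0 rfl, h₂.agents]
    · intro i s' y hs
      exact hs.congr (by simp) (by simp) fun _ _ _ => id
    · exact hs₂.congr rfl rfl (by omega)
    · intro b s₃ hb hf₃ hv₃ hs₃
      have h₃ : IsPrepared N n m g P G ord s₃ :=
        h₂.congr (hf₃ 0 rfl) (hf₃ 2 rfl) (hf₃ 5 rfl) (hf₃ 11 rfl)
      refine (wp_inspectColours h₃ ?_ ?_ hv₃ (Nat.le_of_lt_succ hk) ha hb hs₃).mono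
        fun s' _ hs' => hs'.congr rfl rfl ?_
      · rw [hf₃ 24 rfl, hf₂ 24 rfl, hv₁]
      · rw [hf₃ 25 rfl, hv₂]
      · omega
    · intro s' _ hs'
      exact hs'.congr rfl rfl (by omega)
  · intro s' _ hs'
    exact hs'.congr rfl rfl (by omega)

/-- Sweeps until a sweep changes nothing. -/
def balanceAllColours : Cmd :=
  .seq (.set 23 (.const 1)) (.loop (.var 23) (.seq (.set 23 (.const 0)) sweepColours))

theorem wp_balanceAllColours {N n m g P : ℕ} {G : ℕ → ℕ → ℕ} {ord : ℕ → ℕ} {s : Store}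
    (h : IsPrepared N n m g P G ord s) (hN : (g + 1) * (n * m ^ 2) + 1 ≤ N) :
    Wp N balanceAllColours (fun s' => IsShuffle n (s 4) (s' 4) ∧ ∀ k ≤ g, ∀ a < n, ∀ b < n,
      colourCount m (G k) (s' 4) a ≤ colourCount m (G k) (s' 4) b + 1) s := by
  refine wp_seq (wp_assign ((wp_loop (i := potential n m (g + 1) G (s 4) + 1) (fun i s' =>
    IsPrepared N n m g P G ord s' ∧ IsShuffle n (s 4) (s' 4) ∧
      potential n m (g + 1) G (s' 4) ≤ i ∧ (s' 23 0 0 ≠ 0 → potential n m (g + 1) G (s' 4) < i) ∧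
      (s' 23 0 0 = 0 → ∀ k ≤ g, ∀ a < n, ∀ b < n,
        colourCount m (G k) (s' 4) a ≤ colourCount m (G k) (s' 4) b + 1)) ?_ ?_ ?_).mono ?_))
  · rintro i s₁ ⟨h₁, hsh, -, hi, -⟩ hne
    specialize hi hne
    refine wp_seq (wp_assign ((wp_sweepColours (h₁.congr ?_ ?_ ?_ ?_) ?_).mono
      fun s' hf hsw => ?_))
    · simp
    · simp
    · simp
    · simp
    · simp [Expr.eval]
    simp only [Store.write_of_ne _ (show 4 ≠ 23 by decide)] at hsw
    obtain ⟨hsh', hsw⟩ := hsw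
    have h' : IsPrepared N n m g P G ord s' := by
      refine h₁.congr ?_ ?_ ?_ ?_
      · simp [hf 0 rfl]
      · simp [hf 2 rfl]
      · simp [hf 5 rfl]
      · simp [hf 11 rfl]
    refine ⟨potential n m (g + 1) G (s₁ 4), hi, h', fun f e => (hsh' f e).trans (hsh f e), ?_⟩
    rcases hsw with ⟨h0, h4, hbal⟩ | ⟨h0, hlt⟩
    · rw [h4]
      exact ⟨le_rfl, fun hne => absurd h0 hne, fun _ k hk a ha b hb =>
        Nat.le_of_lt_succ (hbal k a b ⟨Nat.lt_succ_of_le hk, ha, hb⟩)⟩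
    · exact ⟨hlt.le, fun _ => hlt, fun h => absurd h h0⟩
  · exact (Nat.succ_le_succ (potential_le h.indicator_le _)).trans hN
  · refine ⟨h.congr ?_ ?_ ?_ ?_, ?_, ?_, ?_, ?_⟩
    · simp
    · simp
    · simp
    · simp
    · simp [IsShuffle]
    · simp
    · simp
    · simp [Expr.eval]
  · rintro s' - ⟨h0, i, -, hsh, -, -, hbal⟩
    exact ⟨hsh, hbal h0⟩

/-! ### The program that sorts the groups by size -/

/-- Adds the group of all agents, with number `g`. -/
def addAllAgents : Cmd :=
  .forBelow 10 agentsExpr (.assign 2 (.read 0 (.const 2) (.const 0)) (.var 10) (.const 1))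

theorem wp_addAllAgents {N n g : ℕ} {s : Store} (hn : s 0 0 0 = n) (hg : s 0 2 0 = g)
    (hN : n ≤ N) :
    Wp N addAllAgents (fun s' => ∀ k x, s' 2 k x = if k = g ∧ x < n then 1 else s 2 k x) s := by
  refine wp_forBelow (h := n)
    (fun i s' => ∀ k x, s' 2 k x = if k = g ∧ x < i then 1 else s 2 k x) rfl hN ?_ ?_ ?_ ?_
  · intro s' hf
    simp [Expr.eval, hf 0 rfl, hn]
  · intro i s' y h
    simpa using h
  · simp
  · intro i s' hi hf hv h
    refine wp_assign ?_
    intro k x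
    simp [Expr.eval, Store.write_apply, hv, hf 0 rfl, hg, h]
    grind

/-- The list `5[0, 0], …, 5[P - 1, 0]`, where `P` is the variable `11`, has as entries precisely the
`k` with `D k`, sorted by their size `σ k`, and its length is at most `B`. -/
structure IsSortedList (σ : ℕ → ℕ) (D : ℕ → Prop) (B : ℕ) (s : Store) : Prop where
  entry : ∀ l < s 11 0 0, D (s 5 l 0)
  exists_entry : ∀ k, D k → ∃ l < s 11 0 0, s 5 l 0 = k
  sorted : ∀ p q, p ≤ q → q < s 11 0 0 → σ (s 5 p 0) ≤ σ (s 5 q 0)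
  length_le : s 11 0 0 ≤ B

theorem IsSortedList.congr {σ : ℕ → ℕ} {D D' : ℕ → Prop} {B B' : ℕ} {s s' : Store}
    (h : IsSortedList σ D B s) (h5 : s' 5 = s 5) (h11 : s' 11 = s 11) (hD : ∀ k, D' k ↔ D k)
    (hB : B ≤ B') : IsSortedList σ D' B' s' := by
  obtain rfl : D' = D := funext fun k => propext (hD k)
  refine ⟨?_, ?_, ?_, ?_⟩ <;> rw [h11]
  · rw [h5]; exact h.1
  · rw [h5]; exact h.2
  · rw [h5]; exact h.3
  · exact h.4.trans hB

theorem IsSortedList.append {σ : ℕ → ℕ} {D D' : ℕ → Prop} {B k : ℕ} {s s' : Store}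
    (h : IsSortedList σ D B s) (h11 : s' 11 0 0 = s 11 0 0 + 1)
    (h5 : ∀ l, s' 5 l 0 = if l = s 11 0 0 then k else s 5 l 0) (hD : ∀ k', D' k' ↔ D k' ∨ k' = k)
    (hk : ∀ k', D k' → σ k' ≤ σ k) : IsSortedList σ D' (B + 1) s' where
  entry l hl := by
    rw [h5, hD]
    split_ifs with hlP
    · exact .inr rfl
    · exact .inl (h.entry l (by omega))
  exists_entry k' hk' := by
    rcases (hD k').1 hk' with hk' | rfl
    · obtain ⟨l, hl, rfl⟩ := h.exists_entry k' hk'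
      exact ⟨l, by omega, by rw [h5, if_neg hl.ne]⟩
    · exact ⟨s 11 0 0, by omega, by rw [h5, if_pos rfl]⟩
  sorted p q hpq hq := by
    rw [h5, h5]
    split_ifs with h₁ h₂ h₂
    · rfl
    · omega
    · exact hk _ (h.entry p (by omega))
    · exact h.sorted p q hpq (by omega)
  length_le := by
    rw [h11]
    exact Nat.succ_le_succ h.length_le

/-- Lists the groups by size: for every size, all groups are inspected. -/
def sortGroups : Cmd :=
  .seq (.set 11 (.const 0)) (.forBelow 12 (.add agentsExpr (.const 1)) (.forBelow 13 groupsExpr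
    (.seq (.set 14 (.const 0)) (.seq
      (.forBelow 15 agentsExpr (.set 14 (.add (.var 14) (.read 2 (.var 13) (.var 15)))))
      (.branch (.dist (.var 14) (.var 12)) .skip
        (.seq (.assign 5 (.var 11) (.const 0) (.var 13))
          (.set 11 (.add (.var 11) (.const 1)))))))))

theorem wp_sortGroups {N n g : ℕ} {s : Store} (hn : s 0 0 0 = n) (hg : s 0 2 0 = g)
    (hnN : n + 1 ≤ N) (hgN : g + 1 ≤ N) (h01 : ∀ k x, s 2 k x ≤ 1) :
    Wp N sortGroups (IsSortedList (fun k => ∑ x ∈ Finset.range n, s 2 k x) (fun k => k < g + 1)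
      ((n + 1) * (g + 1))) s := by
  set σ : ℕ → ℕ := fun k => ∑ x ∈ Finset.range n, s 2 k x with hσ
  have hσn : ∀ k, σ k ≤ n := by
    intro k
    refine (Finset.sum_le_card_nsmul _ _ 1 fun x _ => h01 k x).trans ?_
    simp
  refine wp_seq (wp_assign ((wp_forBelow (h := n + 1)
    (fun t => IsSortedList σ (fun k => k < g + 1 ∧ σ k < t) (t * (g + 1)))
    rfl hnN ?_ ?_ ?_ ?_).mono ?_))
  · intro s' hf
    simp [Expr.eval, hf 0 rfl, hn]
  · intro i s' y h
    exact h.congr (by simp) (by simp) (fun _ => Iff.rfl) le_rfl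
  · refine ⟨?_, ?_, ?_, ?_⟩ <;> simp [Expr.eval]
  · intro t s₁ ht hf₁ hv₁ h₁
    refine (wp_forBelow (h := g + 1) (fun i => IsSortedList σ
      (fun k => (k < g + 1 ∧ σ k < t) ∨ k < i ∧ σ k = t) (t * (g + 1) + i))
      rfl hgN ?_ ?_ ?_ ?_).mono ?_
    · intro s' hf
      simp [Expr.eval, hf 0 rfl, hf₁ 0 rfl, hg]
    · intro i s' y h
      exact h.congr (by simp) (by simp) (fun _ => Iff.rfl) le_rfl
    · exact h₁.congr rfl rfl (fun k => by simp) le_rfl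
    · intro k s₂ hk hf₂ hv₂ h₂
      refine wp_seq (wp_assign (wp_seq ((wp_forBelow (h := n)
        (fun i s' => s' 14 0 0 = ∑ x ∈ Finset.range i, s 2 k x) rfl (by omega) ?_ ?_ ?_ ?_).mono
          ?_)))
      · intro s' hf
        simp [Expr.eval, hf 0 rfl, hf₂ 0 rfl, hf₁ 0 rfl, hn]
      · intro i s' y h
        simpa using h
      · simp [Expr.eval]
      · intro i s' hi hf hv h
        refine wp_assign ?_
        simp [Expr.eval, h, hv, Finset.sum_range_succ, hf 2 rfl, hf 13 rfl, hf₂ 2 rfl, hf₁ 2 rfl,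
          hv₂]
      · intro s₃ hf₃ h14
        have h13 : s₃ 13 0 0 = k := by simp [hf₃ 13 rfl, hv₂]
        have h12 : s₃ 12 0 0 = t := by simp [hf₃ 12 rfl, hf₂ 12 rfl, hv₁]
        have h₃ : IsSortedList σ (fun k' => (k' < g + 1 ∧ σ k' < t) ∨ k' < k ∧ σ k' = t)
            (t * (g + 1) + k) s₃ :=
          h₂.congr (by simp [hf₃ 5 rfl]) (by simp [hf₃ 11 rfl]) (fun _ => Iff.rfl) le_rfl
        refine wp_branch (fun hne => wp_skip ?_) fun heq => wp_seq (wp_assign (wp_assign ?_))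
        · rw [ne_eq, Expr.eval_dist_eq_zero] at hne
          simp only [Expr.eval, h14, h12] at hne
          refine h₃.congr rfl rfl (fun k' => ?_) (by omega)
          have : k' = k → σ k' ≠ t := by
            rintro rfl
            exact hne
          grind
        · rw [Expr.eval_dist_eq_zero] at heq
          simp only [Expr.eval, h14, h12] at heq
          refine h₃.append (k := k) ?_ ?_ (fun k' => ?_) ?_
          · simp [Expr.eval]
          · intro l
            simp [Expr.eval, Store.write_apply, h13]
          · have : k' = k → σ k' = t := by
              rintro rfl
              exact heq
            grind
          · have : σ k = t := heq
            rintro k' (⟨-, hk'⟩ | ⟨-, hk'⟩) <;> omega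
    · intro s' _ h'
      refine h'.congr rfl rfl (fun k => ?_) (by rw [Nat.add_mul, one_mul])
      constructor
      · rintro ⟨hk, hlt⟩
        rcases Nat.lt_succ_iff_lt_or_eq.1 hlt with hlt | heq
        · exact .inl ⟨hk, hlt⟩
        · exact .inr ⟨hk, heq⟩
      · rintro (⟨hk, hlt⟩ | ⟨hk, heq⟩) <;> exact ⟨hk, by omega⟩
  · intro s' _ h'
    exact h'.congr rfl rfl
      (fun k => ⟨fun hk => ⟨hk, Nat.lt_succ_of_le (hσn k)⟩, fun hk => hk.1⟩) le_rfl

/-! ### The program for the initial table -/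

/-- The copies `R 0, …, R (n - 1)` of one item, for which `w` has the values of the agents, go to
agents that want the item, or nowhere, which is encoded by `n`. Furthermore, for those of the groups
`H 0, …, H (P - 1)` that stand at position `j` or later and have a member who wants the item, the
copies that belong to the members of the group go to members of the group. -/
def IsRow (n P j : ℕ) (H : ℕ → ℕ → ℕ) (w R : ℕ → ℕ) : Prop :=
  (∀ c < n, R c = n ∨ R c < n ∧ w (R c) ≠ 0) ∧
    ∀ l < P, j ≤ l → (∃ x < n, H l x ≠ 0 ∧ w x ≠ 0) → ∀ c < n, H l c ≠ 0 → H l (R c) ≠ 0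

theorem IsRow.of_forall {n P j : ℕ} {H : ℕ → ℕ → ℕ} {w R : ℕ → ℕ} (h : IsRow n P (j + 1) H w R)
    (hj : ∀ x < n, ¬(H j x ≠ 0 ∧ w x ≠ 0)) : IsRow n P j H w R := by
  refine ⟨h.1, fun l hl hjl hex => ?_⟩
  rcases hjl.eq_or_lt with rfl | hjl
  · obtain ⟨x, hx, hx'⟩ := hex
    exact absurd hx' (hj x hx)
  · exact h.2 l hl hjl hex

/-- In the step to a smaller group, the copies that belong to its members go to a member who wants
the item. This remains within every larger group that is not disjoint from it. -/
theorem IsRow.update {n P j x : ℕ} {H : ℕ → ℕ → ℕ} {w R R' : ℕ → ℕ}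
    (h : IsRow n P (j + 1) H w R) (hH : IsNested P H) (hH1 : ∀ l y, H l y ≤ 1) (hx : x < n)
    (hjx : H j x ≠ 0) (hwx : w x ≠ 0) (hR : ∀ c < n, R' c = if H j c ≠ 0 then x else R c) :
    IsRow n P j H w R' := by
  have hone : ∀ l y, H l y ≠ 0 ↔ H l y = 1 := fun l y => by have := hH1 l y; omega
  refine ⟨fun c hc => ?_, fun l hl hjl hex c hc hlc => ?_⟩
  · rw [hR c hc]
    split_ifs
    · exact .inr ⟨hx, hwx⟩
    · exact h.1 c hc
  · rw [hR c hc]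
    by_cases hjc : H j c ≠ 0
    · rw [if_pos hjc]
      rcases hH j l hjl hl with hsub | hdis
      · rw [hsub x ((hone j x).1 hjx)]
        exact one_ne_zero
      · exact absurd (hdis c ((hone j c).1 hjc)) hlc
    · rw [if_neg hjc]
      have hne : j ≠ l := by
        rintro rfl
        exact hjc hlc
      exact h.2 l hl (by omega) hex c hc hlc

/-- Sets the variable `20` to `x + 1` for a member `x` of the group `k` (variable `19`) who wants
the item `e` (variable `16`), or to `0` if there is none. -/
def findMember : Cmd :=
  .seq (.set 20 (.const 0)) (.forBelow 21 agentsExpr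
    (.branch (.read 2 (.var 19) (.var 21)) (.branch (.read 1 (.var 21) (.var 16))
      (.set 20 (.add (.var 21) (.const 1))) .skip) .skip))

theorem wp_findMember {N n k e : ℕ} {s : Store} (hn : s 0 0 0 = n) (hN : n ≤ N)
    (hk : s 19 0 0 = k) (he : s 16 0 0 = e) :
    Wp N findMember (fun s' =>
      (s' 20 0 0 = 0 ∧ ∀ x < n, ¬(s 2 k x ≠ 0 ∧ s 1 x e ≠ 0)) ∨
        ∃ x < n, s' 20 0 0 = x + 1 ∧ s 2 k x ≠ 0 ∧ s 1 x e ≠ 0) s := by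
  refine wp_seq (wp_assign (wp_forBelow (h := n) (fun i s' =>
      (s' 20 0 0 = 0 ∧ ∀ x < i, ¬(s 2 k x ≠ 0 ∧ s 1 x e ≠ 0)) ∨
        ∃ x < n, s' 20 0 0 = x + 1 ∧ s 2 k x ≠ 0 ∧ s 1 x e ≠ 0) rfl hN ?_ ?_ ?_ ?_))
  · intro s' hf
    simp [Expr.eval, hf 0 rfl, hn]
  · intro i s' y h
    simpa using h
  · simp [Expr.eval]
  · intro i s' hi hf hv h
    have h19 : s' 19 0 0 = k := by simp [hf 19 rfl, hk]
    have h16 : s' 16 0 0 = e := by simp [hf 16 rfl, he]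
    have h2 : s' 2 = s 2 := by simp [hf 2 rfl]
    have h1 : s' 1 = s 1 := by simp [hf 1 rfl]
    have hskip : ¬(s 2 k i ≠ 0 ∧ s 1 i e ≠ 0) →
        (s' 20 0 0 = 0 ∧ ∀ x < i + 1, ¬(s 2 k x ≠ 0 ∧ s 1 x e ≠ 0)) ∨
        ∃ x < n, s' 20 0 0 = x + 1 ∧ s 2 k x ≠ 0 ∧ s 1 x e ≠ 0 := by
      intro hi'
      refine h.imp (fun ⟨h₁, h₂⟩ => ⟨h₁, fun x hx => ?_⟩) id
      rcases Nat.lt_succ_iff_lt_or_eq.1 hx with hx | rfl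
      · exact h₂ x hx
      · exact hi'
    refine wp_branch (fun hne => wp_branch (fun hne' => wp_assign ?_) fun heq => wp_skip ?_)
      fun heq => wp_skip ?_
    · simp only [Expr.eval, h19, hv, h2, h1, h16] at hne hne'
      refine .inr ⟨i, hi, ?_, hne, hne'⟩
      simp [Expr.eval, hv]
    · simp only [Expr.eval, hv, h1, h16] at heq
      exact hskip fun h => h.2 heq
    · simp only [Expr.eval, hv, h2, h19] at heq
      exact hskip fun h => h.1 heq

/-- Gives the copies of the item `e` (variable `16`) that belong to the members of the group `k`
(variable `19`) to the member that `findMember` found. -/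
def giveToMember : Cmd :=
  .branch (.var 20) (.forBelow 22 agentsExpr (.branch (.read 2 (.var 19) (.var 22))
    (.assign 4 (.var 16) (.var 22) (.sub (.var 20) (.const 1))) .skip)) .skip

theorem wp_giveToMember {N n k e : ℕ} {s : Store} (hn : s 0 0 0 = n) (hN : n ≤ N)
    (hk : s 19 0 0 = k) (he : s 16 0 0 = e) :
    Wp N giveToMember (fun s' => (∀ e', e' ≠ e → s' 4 e' = s 4 e') ∧
      (s 20 0 0 = 0 → s' 4 = s 4) ∧ ∀ x, s 20 0 0 = x + 1 →
        ∀ c < n, s' 4 e c = if s 2 k c ≠ 0 then x else s 4 e c) s := by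
  refine wp_branch (fun hne => ?_) fun heq => wp_skip ?_
  · simp only [Expr.eval] at hne
    obtain ⟨x, hx⟩ := Nat.exists_eq_succ_of_ne_zero hne
    refine (wp_forBelow (h := n) (fun i s' => ∀ e' c, s' 4 e' c =
      if e' = e ∧ c < i ∧ s 2 k c ≠ 0 then x else s 4 e' c) rfl hN ?_ ?_ ?_ ?_).mono ?_
    · intro s' hf
      simp [Expr.eval, hf 0 rfl, hn]
    · intro i s' y h
      simpa using h
    · simp
    · intro i s' hi hf hv h
      refine wp_branch (fun hne => wp_assign ?_) fun heq => wp_skip ?_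
      · simp only [Expr.eval, hv, hf 2 rfl, hf 19 rfl, hk] at hne
        intro e' c
        simp [Expr.eval, Store.write_apply, hv, hf 16 rfl, he, hf 20 rfl, hx, h]
        grind
      · simp only [Expr.eval, hv, hf 2 rfl, hf 19 rfl, hk] at heq
        intro e' c
        rw [h]
        grind
    · intro s' hf h
      refine ⟨fun e' he' => ?_, fun h0 => absurd h0 hne, fun y hy c hc => ?_⟩
      · funext c
        simp [h, he']
      · obtain rfl : x = y := by omega
        simp [h, hc]
  · simp only [Expr.eval] at heq
    refine ⟨fun _ _ => rfl, fun _ => rfl, fun x hx => ?_⟩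
    omega

/-- Fills the row of every item: at first no agent gets a copy; then the groups are treated from
the largest to the smallest. -/
def fillTable : Cmd :=
  .forBelow 16 itemsExpr (.seq
    (.forBelow 17 agentsExpr (.assign 4 (.var 16) (.var 17) agentsExpr))
    (.forBelow 18 (.var 11)
      (.seq (.set 19 (.read 5 (.sub (.var 11) (.add (.var 18) (.const 1))) (.const 0)))
        (.seq findMember giveToMember))))

theorem wp_fillTable {N n m g P : ℕ} {G : ℕ → ℕ → ℕ} {ord : ℕ → ℕ} {s : Store}
    (h : IsPrepared N n m g P G ord s) :
    Wp N fillTable (fun s' => ∀ e < m,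
      IsRow n P 0 (fun l => G (ord l)) (fun x => s 1 x e) (s' 4 e)) s := by
  refine wp_forBelow (h := m) (fun i s' => ∀ e < i,
    IsRow n P 0 (fun l => G (ord l)) (fun x => s 1 x e) (s' 4 e)) rfl h.items_le ?_ ?_ ?_ ?_
  · intro s' hf
    simp [Expr.eval, hf 0 rfl, h.items]
  · intro i s' y h
    simpa using h
  · intro e he
    exact absurd he (Nat.not_lt_zero e)
  intro e s₁ he hf₁ hv₁ h₁
  have hp₁ : IsPrepared N n m g P G ord s₁ :=
    h.congr (hf₁ 0 rfl) (hf₁ 2 rfl) (hf₁ 5 rfl) (hf₁ 11 rfl)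
  refine wp_seq ((wp_forBelow (h := n) (fun i s' => (∀ e' < e, s' 4 e' = s₁ 4 e') ∧
    ∀ c < i, s' 4 e c = n) rfl h.agents_le ?_ ?_ ?_ ?_).mono ?_)
  · intro s' hf
    simp [Expr.eval, hf 0 rfl, hp₁.agents]
  · intro i s' y h
    simpa using h
  · simp
  · rintro i s' hi hf hv ⟨hrows, hrow⟩
    refine wp_assign ⟨fun e' he' => ?_, fun c hc => ?_⟩
    · funext c
      simp [Expr.eval, Store.write_apply, hf 16 rfl, hv₁, he'.ne, hrows e' he']
    · have := hrow c
      simp [Expr.eval, Store.write_apply, hf 16 rfl, hv₁, hv, hf 0 rfl, hp₁.agents]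
      grind
  rintro s₂ hf₂ ⟨hrows₂, hrow₂⟩
  have hp₂ : IsPrepared N n m g P G ord s₂ :=
    hp₁.congr (hf₂ 0 rfl) (hf₂ 2 rfl) (hf₂ 5 rfl) (hf₂ 11 rfl)
  refine (wp_forBelow (h := P) (fun i s' => (∀ e' < e, s' 4 e' = s₁ 4 e') ∧
    IsRow n P (P - i) (fun l => G (ord l)) (fun x => s 1 x e) (s' 4 e))
    rfl h.length_le ?_ ?_ ?_ ?_).mono ?_
  · intro s' hf
    simp [Expr.eval, hf 11 rfl, hp₂.length]
  · intro i s' y h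
    simpa using h
  · exact ⟨hrows₂, fun c hc => .inl (hrow₂ c hc), fun l hl hl' => by omega⟩
  · rintro i s₃ hi hf₃ hv₃ ⟨hrows, hrow⟩
    have hp₃ : IsPrepared N n m g P G ord s₃ :=
      hp₂.congr (hf₃ 0 rfl) (hf₃ 2 rfl) (hf₃ 5 rfl) (hf₃ 11 rfl)
    have h1 : s₃ 1 = s 1 := by rw [hf₃ 1 rfl, hf₂ 1 rfl, hf₁ 1 rfl]
    have h16 : s₃ 16 0 0 = e := by rw [hf₃ 16 rfl, hf₂ 16 rfl, hv₁]
    obtain ⟨j, hj⟩ : ∃ j, P = i + 1 + j := Nat.exists_eq_add_of_lt hi |>.imp fun j hj => by omega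
    have hord : (Expr.read 5 (.sub (.var 11) (.add (.var 18) (.const 1))) (.const 0)).eval s₃ =
        ord j := by
      simp only [Expr.eval, hv₃, hp₃.length, hp₃.order]
      congr 1
      omega
    rw [show P - i = j + 1 by omega] at hrow
    rw [show P - (i + 1) = j by omega]
    refine wp_seq (wp_assign (wp_seq ((wp_findMember (n := n) (k := ord j) (e := e) ?_ h.agents_le
      ?_ ?_).mono fun s₄ hf₄ hfind => ?_)))
    · simp [hp₃.agents]
    · simp only [hord]
      simp [Expr.eval]
    · simp [h16]
    simp only [Store.write_of_ne _ (show 2 ≠ 19 by decide), h1,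
      Store.write_of_ne _ (show 1 ≠ 19 by decide), hp₃.indicator] at hfind
    refine (wp_giveToMember (n := n) (k := ord j) (e := e) ?_ h.agents_le ?_ ?_).mono
      fun s₅ hf₅ ⟨hrows₅, h0, hx⟩ => ?_
    · simp [hf₄ 0 rfl, hp₃.agents]
    · rw [hf₄ 19 rfl, hord]
      simp [Expr.eval]
    · simp [hf₄ 16 rfl, h16]
    have h4 : s₄ 4 = s₃ 4 := by simp [hf₄ 4 rfl]
    have h2 : s₄ 2 = G := by simp [hf₄ 2 rfl, hp₃.indicator]
    refine ⟨fun e' he' => by rw [hrows₅ e' he'.ne, h4, hrows e' he'], ?_⟩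
    rcases hfind with ⟨hz, hnone⟩ | ⟨x, hxn, hxs, hGx, hwx⟩
    · rw [h0 hz, h4]
      exact hrow.of_forall hnone
    · refine hrow.update h.nested (fun l y => h.indicator_le _ _) hxn hGx hwx fun c hc => ?_
      rw [hx x hxs c hc, h2, h4]
  · rintro s' hf' ⟨hrows, hrow⟩ e' he'
    rcases Nat.lt_succ_iff_lt_or_eq.1 he' with he' | rfl
    · rw [hrows e' he']
      exact h₁ e' he'
    · simpa using hrow

/-! ### The table of a dichotomous laminar instance -/

namespace AllocInstance

variable {n m g : ℕ} (I : AllocInstance n m g)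

theorem input_one (x e : ℕ) :
    I.input 1 x e = if h : x < n ∧ e < m then ⌊I.v ⟨x, h.1⟩ ⟨e, h.2⟩⌋₊ else 0 := rfl

theorem input_two (k x : ℕ) : I.input 2 k x = if h : k < g ∧ x < n then
    (if (⟨x, h.2⟩ : Fin n) ∈ I.group ⟨k, h.1⟩ then 1 else 0) else 0 := rfl

theorem input_one_ne_zero {I : AllocInstance n m g} (hI : I.Dichotomous) (i : Fin n) (e : Fin m) :
    I.input 1 i e ≠ 0 ↔ I.v i e = 1 := by
  rw [input_one, dif_pos ⟨i.2, e.2⟩]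
  rcases hI i e with h | h <;> simp [h]

theorem input_two_fin (k : Fin g) (i : Fin n) :
    I.input 2 k i = if i ∈ I.group k then 1 else 0 := by
  rw [input_two, dif_pos ⟨k.2, i.2⟩]

theorem sum_input_two (k : Fin g) :
    ∑ x ∈ Finset.range n, I.input 2 k x = (I.group k).card := by
  rw [Finset.sum_range]
  simp [input_two_fin]

/-- The `k`-th protected group for `k < g`, and otherwise the group of all agents. -/
def extendedGroup (k : ℕ) : Finset (Fin n) := if h : k < g then I.group ⟨k, h⟩ else Finset.univ

theorem extendedGroup_laminar {I : AllocInstance n m g} (hI : I.Laminar) (k l : ℕ) :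
    Disjoint (I.extendedGroup k) (I.extendedGroup l) ∨ I.extendedGroup k ⊆ I.extendedGroup l ∨
      I.extendedGroup l ⊆ I.extendedGroup k := by
  unfold extendedGroup
  split_ifs
  · exact hI _ _
  · exact .inr (.inl (Finset.subset_univ _))
  · exact .inr (.inr (Finset.subset_univ _))
  · exact .inr (.inl (Finset.subset_univ _))

/-- The indicator function of the `k`-th extended group on the natural numbers. -/
def indicator (k x : ℕ) : ℕ := if k = g ∧ x < n then 1 else I.input 2 k x

theorem indicator_le_one (k x : ℕ) : I.indicator k x ≤ 1 := by
  unfold indicator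
  rw [input_two]
  split_ifs <;> simp

theorem indicator_eq_one {k : ℕ} (hk : k ≤ g) (x : ℕ) :
    I.indicator k x = 1 ↔ ∃ h : x < n, (⟨x, h⟩ : Fin n) ∈ I.extendedGroup k := by
  unfold indicator extendedGroup
  rw [input_two]
  rcases hk.lt_or_eq with hk | rfl
  · by_cases hx : x < n <;> simp [hk, hk.ne, hx]
  · simp

theorem indicator_fin (k : Fin g) : I.indicator k = I.input 2 k := by
  funext x
  simp [indicator, k.2.ne]

theorem sum_indicator {k : ℕ} (hk : k ≤ g) :
    ∑ x ∈ Finset.range n, I.indicator k x = (I.extendedGroup k).card := by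
  have h : ∀ i : Fin n, I.indicator k i = if i ∈ I.extendedGroup k then 1 else 0 := by
    intro i
    have h1 := I.indicator_le_one k i
    have h2 := I.indicator_eq_one hk i
    split_ifs with hi
    · exact h2.2 ⟨i.2, hi⟩
    · have : ¬ I.indicator k i = 1 := fun h => hi (h2.1 h).2
      omega
  simp [Finset.sum_range, h]

/-- In a laminar family a group can only be contained in a larger one or disjoint from it, so that
sorting by size suffices. -/
theorem isNested_of_sorted {I : AllocInstance n m g} (hI : I.Laminar) {P : ℕ} {ord : ℕ → ℕ}
    (hord : ∀ l < P, ord l ≤ g) (hsort : ∀ p q, p ≤ q → q < P →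
      ∑ x ∈ Finset.range n, I.indicator (ord p) x ≤
        ∑ x ∈ Finset.range n, I.indicator (ord q) x) :
    IsNested P fun l => I.indicator (ord l) := by
  intro p q hpq hq
  have hp' := hord p (by omega)
  have hq' := hord q hq
  have hcard := hsort p q hpq hq
  rw [I.sum_indicator hp', I.sum_indicator hq'] at hcard
  have hsub : I.extendedGroup (ord p) ⊆ I.extendedGroup (ord q) →
      ∀ x, I.indicator (ord p) x = 1 → I.indicator (ord q) x = 1 := by
    intro h x
    rw [I.indicator_eq_one hp', I.indicator_eq_one hq']
    rintro ⟨hx, hx'⟩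
    exact ⟨hx, h hx'⟩
  rcases extendedGroup_laminar hI (ord p) (ord q) with h | h | h
  · refine .inr fun x hx => ?_
    have h1 := I.indicator_le_one (ord q) x
    have : ¬ I.indicator (ord q) x = 1 := by
      rw [I.indicator_eq_one hp'] at hx
      rw [I.indicator_eq_one hq']
      obtain ⟨_, hx⟩ := hx
      rintro ⟨_, hx'⟩
      exact Finset.disjoint_left.1 h hx hx'
    change I.indicator (ord q) x = 0
    omega
  · exact .inl (hsub h)
  · exact .inl (hsub (Finset.eq_of_subset_of_card_le h hcard).ge)

/-- The items that some member of the group `G` wants. -/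
def wanted (G : Finset (Fin n)) : Finset (Fin m) :=
  Finset.univ.filter fun e => ∃ i ∈ G, I.v i e = 1

/-- A table of the agents that get the copies of the items in the `n` colours. Each colour
describes an allocation in which items go only to agents that want them (or, as encoded by `n`,
to nobody), every protected group gets on average over the colours its proportional share, and
different colours differ by at most one in the number of items that a protected group gets. -/
structure IsTable (T : ℕ → ℕ → ℕ) : Prop where
  wants : ∀ e < m, ∀ c < n, T e c = n ∨ T e c < n ∧ I.input 1 (T e c) e ≠ 0
  average : ∀ k : Fin g, (I.group k).card * (I.wanted (I.group k)).card ≤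
    ∑ c ∈ Finset.range n, colourCount m (I.input 2 k) T c
  balanced : ∀ k : Fin g, ∀ a < n, ∀ b < n,
    colourCount m (I.input 2 k) T a ≤ colourCount m (I.input 2 k) T b + 1

/-- Shuffling the copies of the items preserves the agents that get them, so a balanced
shuffle of a table filled row by row as in `IsRow` is as required. -/
theorem isTable_of_isShuffle {I : AllocInstance n m g} (hI : I.Dichotomous) {P : ℕ} {ord : ℕ → ℕ}
    {T T' : ℕ → ℕ → ℕ} (hord : ∀ k ≤ g, ∃ l < P, ord l = k)
    (hT : ∀ e < m, IsRow n P 0 (fun l => I.indicator (ord l)) (fun x => I.input 1 x e) (T e))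
    (hT' : IsShuffle n T T') (hbal : ∀ k ≤ g, ∀ a < n, ∀ b < n,
      colourCount m (I.indicator k) T' a ≤ colourCount m (I.indicator k) T' b + 1) :
    I.IsTable T' where
  wants e he c hc := by
    classical
    by_contra hcon
    -- a shuffle preserves the number of copies of `e` that go to a wrong place, namely zero
    have h := hT' (fun x => if x = n ∨ x < n ∧ I.input 1 x e ≠ 0 then 0 else 1) e
    have h0 : ∑ c ∈ Finset.range n,
        (if T e c = n ∨ T e c < n ∧ I.input 1 (T e c) e ≠ 0 then 0 else 1) = 0 :=
      Finset.sum_eq_zero fun c hc => if_pos ((hT e he).1 c (Finset.mem_range.1 hc))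
    rw [h0, Finset.sum_eq_zero_iff] at h
    have := h c (Finset.mem_range.2 hc)
    rw [if_neg hcon] at this
    exact one_ne_zero this
  average k := by
    obtain ⟨l, hl, hlk⟩ := hord k k.2.le
    unfold colourCount
    rw [Finset.sum_comm, Finset.sum_range, mul_comm, ← smul_eq_mul]
    refine (Finset.card_nsmul_le_sum (I.wanted (I.group k)) _ _ fun e he => ?_).trans
      (Finset.sum_le_univ_sum_of_nonneg fun _ => Nat.zero_le _)
    rw [hT' (I.input 2 k) e, ← I.sum_input_two k]
    refine Finset.sum_le_sum fun c hc => ?_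
    obtain ⟨i, hi, hie⟩ := (Finset.mem_filter.1 he).2
    have hrow := (hT e e.2).2 l hl (Nat.zero_le _) ⟨i, i.2, ?_⟩ c (Finset.mem_range.1 hc)
    · simp only [hlk, indicator_fin] at hrow
      have h1 := I.indicator_le_one k c
      rw [indicator_fin] at h1
      omega
    · simp only [hlk, indicator_fin, input_two_fin, if_pos hi]
      exact ⟨one_ne_zero, (input_one_ne_zero hI i e).2 hie⟩
  balanced k a ha b hb := by
    have := hbal k k.2.le a ha b hb
    rwa [indicator_fin] at this

end AllocInstance

/-- The deterministic part of the algorithm, which computes the table. -/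
def makeTable : Cmd :=
  .seq addAllAgents (.seq sortGroups (.seq fillTable balanceAllColours))

theorem wp_makeTable {N n m g : ℕ} {I : AllocInstance n m g} (hI : I.Dichotomous)
    (hL : I.Laminar) (hN : (n + m + g + 1) ^ 4 + 1 ≤ N) :
    Wp N makeTable (fun s => I.IsTable (s 4)) I.input := by
  have hpow : ∀ i ≤ 4, (n + m + g + 1) ^ i + 1 ≤ N := fun i hi =>
    le_trans (Nat.succ_le_succ (Nat.pow_le_pow_right (Nat.succ_pos _) hi)) hN
  have hN1 := hpow 1 (by norm_num)
  rw [pow_one] at hN1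
  refine wp_seq ((wp_addAllAgents (n := n) (g := g) rfl rfl (by omega)).mono fun s₁ hf₁ h₁ => ?_)
  have hind : s₁ 2 = I.indicator := funext fun k => funext fun x => h₁ k x
  refine wp_seq ((wp_sortGroups (n := n) (g := g) (by rw [hf₁ 0 rfl]; rfl)
    (by rw [hf₁ 0 rfl]; rfl) (by omega) (by omega)
    (by rw [hind]; exact I.indicator_le_one)).mono fun s₂ hf₂ h₂ => ?_)
  have hord : ∀ l < s₂ 11 0 0, s₂ 5 l 0 ≤ g := fun l hl => Nat.le_of_lt_succ (h₂.entry l hl)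
  have hprep : IsPrepared N n m g (s₂ 11 0 0) I.indicator (fun l => s₂ 5 l 0) s₂ := by
    refine ⟨?_, ?_, ?_, ?_, fun _ => rfl, rfl, by omega, by omega, by omega, ?_,
      I.indicator_le_one, fun k hk => h₂.exists_entry k (Nat.lt_succ_of_le hk),
      AllocInstance.isNested_of_sorted hL hord ?_⟩
    · rw [hf₂ 0 rfl, hf₁ 0 rfl]; rfl
    · rw [hf₂ 0 rfl, hf₁ 0 rfl]; rfl
    · rw [hf₂ 0 rfl, hf₁ 0 rfl]; rfl
    · rw [hf₂ 2 rfl, hind]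
    · refine h₂.length_le.trans (le_trans ?_ ((Nat.le_succ _).trans (hpow 2 (by norm_num))))
      rw [pow_two]
      gcongr <;> omega
    · have := h₂.sorted
      rw [hind] at this
      exact this
  refine wp_seq ((wp_fillTable hprep).mono fun s₃ hf₃ h₃ => ?_)
  have h1 : s₂ 1 = I.input 1 := by rw [hf₂ 1 rfl, hf₁ 1 rfl]
  rw [h1] at h₃
  refine (wp_balanceAllColours (hprep.congr (hf₃ 0 rfl) (hf₃ 2 rfl) (hf₃ 5 rfl) (hf₃ 11 rfl))
    ?_).mono fun s₄ hf₄ ⟨hsh, hbal⟩ =>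
      AllocInstance.isTable_of_isShuffle hI hprep.exists_order h₃ hsh hbal
  refine le_trans (Nat.succ_le_succ ?_) hN
  calc (g + 1) * (n * m ^ 2)
      ≤ (n + m + g + 1) * ((n + m + g + 1) * (n + m + g + 1) ^ 2) := by gcongr <;> omega
    _ = (n + m + g + 1) ^ 4 := by ring

/-! ### The random colour -/

/-- Writes the allocation of the colour `41[0, 0]` into the output array. -/
def writeColour : Cmd :=
  .forBelow 42 itemsExpr (.assign 3 (.read 4 (.var 42) (.var 41)) (.var 42) (.const 1))

theorem wp_writeColour {N m r : ℕ} {s : Store} (hm : s 0 1 0 = m) (hN : m ≤ N)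
    (hr : s 41 0 0 = r) :
    Wp N writeColour (fun s' => ∀ x e, s' 3 x e = if e < m ∧ s 4 e r = x then 1 else s 3 x e)
      s := by
  refine wp_forBelow (h := m)
    (fun i s' => ∀ x e, s' 3 x e = if e < i ∧ s 4 e r = x then 1 else s 3 x e) rfl hN ?_ ?_ ?_ ?_
  · intro s' hf
    simp [Expr.eval, hf 0 rfl, hm]
  · intro i s' y h
    simpa using h
  · simp
  · intro i s' hi hf hv h
    refine wp_assign ?_
    intro x e
    simp [Expr.eval, Store.write_apply, hv, hf 41 rfl, hr, hf 4 rfl, h]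
    grind

/-- The algorithm: one of the `n` colours of the table is drawn uniformly. -/
def fairProgram : Cmd :=
  .seq makeTable (.seq (.draw 41 (.const 0) (.const 0) (.sub agentsExpr (.const 1))) writeColour)

/-- The bundles that the colour `r` of the table `T` assigns. -/
def colourBundles (n m : ℕ) (T : ℕ → ℕ → ℕ) (r : ℕ) : Bundles n m :=
  fun i => Finset.univ.filter fun e => T e r = i

/-- The memory `f r` is the result of the run that draws the colour `r`. The time `t` is common to
all outcomes; a run that ends earlier idles for the rest of it. -/
theorem exists_runFor_fairProgram {N n m g t : ℕ} {I : AllocInstance n m g} (hn : 0 < n)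
    (hI : I.Dichotomous) (hL : I.Laminar) (hN : (n + m + g + 1) ^ 4 + 1 ≤ N)
    (ht : fairProgram.time N ≤ t) :
    ∃ (T : ℕ → ℕ → ℕ) (f : ℕ → Store), I.IsTable T ∧
      (∀ r, outputBundles n m (f r) = colourBundles n m T r) ∧
      runFor t ([fairProgram], I.input) =
        (PMF.uniformOfFinset (Finset.range n) (Finset.nonempty_range_iff.2 hn.ne')).map
          fun r => ([], f r) := by
  obtain ⟨s, t₁, he, ht₁, hT⟩ := wp_makeTable hI hL hN
  have h0 : s 0 = I.input 0 := he.eq_of_writes_eq_false rfl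
  have h3 : s 3 = I.input 3 := he.eq_of_writes_eq_false rfl
  have hmN : m ≤ N := by
    have := Nat.le_self_pow (n := 4) (by norm_num) (n + m + g + 1)
    omega
  choose f t₂ he₂ ht₂ hf using fun r : ℕ => wp_writeColour (N := N) (m := m) (r := r)
    (s := s.write 41 0 0 r) (by simp only [Store.write_of_ne _ (show 0 ≠ 41 by decide), h0]; rfl)
    hmN (by simp)
  refine ⟨s 4, f, hT, fun r => ?_, ?_⟩
  · funext i
    ext e
    have : I.input 3 i e = 0 := rfl
    simp [outputBundles, colourBundles, hf, h3, this]
  · simp only [fairProgram, Cmd.time] at ht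
    obtain ⟨u, rfl⟩ : ∃ u, t = 1 + (t₁ + (1 + (1 + u))) := ⟨t - t₁ - 3, by omega⟩
    have hu : writeColour.time N ≤ u := by omega
    rw [fairProgram, runFor_one_add_of_step rfl, he.runFor_add, runFor_one_add_of_step rfl,
      Nat.add_comm, runFor, step, PMF.bind_map, ← PMF.bind_pure_comp]
    have hcard : (Expr.sub agentsExpr (.const 1)).eval s + 1 = n := by
      simp only [Expr.eval, h0]
      exact Nat.succ_pred_eq_of_pos hn
    simp only [hcard]
    congr 1
    funext r
    obtain ⟨w, rfl⟩ := Nat.exists_eq_add_of_le ((ht₂ r).trans hu)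
    simp only [Function.comp_apply, Expr.eval]
    rw [(he₂ r).runFor_add, runFor_halted]

/-! ### Shares and welfare in dichotomous instances -/

namespace AllocInstance

variable {n m g : ℕ} {I : AllocInstance n m g}

theorem groupItemValue_eq_ite (hI : I.Dichotomous) (G : Finset (Fin n)) (e : Fin m) :
    I.groupItemValue G e = if e ∈ I.wanted G then 1 else 0 := by
  unfold groupItemValue
  by_cases h : ∃ i ∈ G, I.v i e = 1
  · rw [if_pos (by simpa [wanted] using h)]
    obtain ⟨i, hi, hie⟩ := h
    refine le_antisymm (Finset.sup_le fun j _ => ?_) ?_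
    · rcases hI j e with h | h <;> simp [h]
    · rw [← hie]
      exact Finset.le_sup (f := fun i => I.v i e) hi
  · rw [if_neg (by simpa [wanted] using h)]
    refine le_antisymm (Finset.sup_le fun j hj => ?_) (zero_le)
    exact ((hI j e).resolve_right fun h' => h ⟨j, hj, h'⟩).le

theorem groupValue_eq_card (hI : I.Dichotomous) (G : Finset (Fin n)) (B : Finset (Fin m)) :
    I.groupValue G B = ((B ∩ I.wanted G).card : ℝ≥0) := by
  unfold groupValue
  simp only [groupItemValue_eq_ite hI, Finset.sum_ite_mem]
  simp

theorem propShare_eq (hI : I.Dichotomous) (G : Finset (Fin n)) :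
    I.propShare G = (G.card : ℝ≥0) * (I.wanted G).card / n := by
  rw [propShare, groupValue_eq_card hI, Finset.univ_inter, div_mul_eq_mul_div]

/-- With equal prices for the items that `G` wants, the budget of `G` buys at most its
proportional share of them, rounded down. -/
theorem anyPriceShare_le (hn : 0 < n) (hI : I.Dichotomous) {G : Finset (Fin n)} {w : ℕ}
    (hw : ∀ b : ℕ, b * n ≤ G.card * (I.wanted G).card → b ≤ w) :
    I.anyPriceShare G ≤ w := by
  rcases Nat.eq_zero_or_pos m with rfl | hm
  · have : Prices 0 = ∅ := by
      ext p
      simp [Prices]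
    rw [anyPriceShare, this, Set.image_empty, NNReal.sInf_empty]
    exact zero_le
  rcases (I.wanted G).eq_empty_or_nonempty with h0 | hne
  · refine ((isLeast_anyPriceShare I hm G).2 ⟨Pi.single ⟨0, hm⟩ 1, by simp [Prices], rfl⟩).trans ?_
    refine Finset.sup_le fun B _ => ?_
    rw [groupValue_eq_card hI, h0]
    simp
  · have hc : ((I.wanted G).card : ℝ≥0) ≠ 0 := by
      exact_mod_cast hne.card_pos.ne'
    have hn' : (0 : ℝ≥0) < n := by exact_mod_cast hn
    let p : Fin m → ℝ≥0 := fun e => if e ∈ I.wanted G then ((I.wanted G).card : ℝ≥0)⁻¹ else 0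
    have hp : ∀ B : Finset (Fin m),
        ∑ e ∈ B, p e = ((B ∩ I.wanted G).card : ℝ≥0) * ((I.wanted G).card : ℝ≥0)⁻¹ := by
      intro B
      simp only [p, Finset.sum_ite_mem]
      simp
    refine ((isLeast_anyPriceShare I hm G).2 ⟨p, ?_, rfl⟩).trans ?_
    · rw [Prices, Set.mem_ofPred_eq, hp, Finset.univ_inter, mul_inv_cancel₀ hc]
    · refine Finset.sup_le fun B hB => ?_
      have hB' := (Finset.mem_filter.1 hB).2
      rw [hp, ← div_eq_mul_inv, div_le_div_iff₀ (pos_iff_ne_zero.2 hc) hn'] at hB'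
      rw [groupValue_eq_card hI]
      exact_mod_cast hw _ (by exact_mod_cast hB')

theorem isAllocation_colourBundles (T : ℕ → ℕ → ℕ) (r : ℕ) :
    IsAllocation (colourBundles n m T r) := by
  intro i j hij
  refine Finset.disjoint_left.2 fun e hi hj => hij (Fin.ext ?_)
  simp only [colourBundles, Finset.mem_filter] at hi hj
  exact hi.2.symm.trans hj.2

theorem IsTable.groupWelfare_eq {T : ℕ → ℕ → ℕ} (hT : I.IsTable T) (hI : I.Dichotomous)
    {r : ℕ} (hr : r < n) (k : Fin g) :
    I.groupWelfare (colourBundles n m T r) (I.group k) = colourCount m (I.input 2 k) T r := by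
  unfold groupWelfare welfare colourBundles colourCount
  simp only [Finset.sum_filter]
  rw [Finset.sum_comm, Finset.sum_range, Nat.cast_sum]
  refine Finset.sum_congr rfl fun e _ => ?_
  rcases hT.wants e e.2 r hr with h | ⟨hlt, hne⟩
  · rw [h, input_two, dif_neg (by simp), Nat.cast_zero]
    exact Finset.sum_eq_zero fun i _ => if_neg i.2.ne'
  · obtain ⟨i, hi⟩ : ∃ i : Fin n, T e r = i := ⟨⟨_, hlt⟩, rfl⟩
    rw [hi] at hne ⊢
    rw [input_two_fin]
    simp only [Fin.val_inj]
    rw [Finset.sum_ite_eq, (input_one_ne_zero hI i e).1 hne]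
    split_ifs <;> simp

/-- If a protected group got fewer than `b` items in the colour `r`, it would get at most `b` in
every colour, and on average less than `b`. -/
theorem IsTable.le_colourCount {T : ℕ → ℕ → ℕ} (hT : I.IsTable T) {r b : ℕ} (hr : r < n)
    {k : Fin g} (hb : b * n ≤ (I.group k).card * (I.wanted (I.group k)).card) :
    b ≤ colourCount m (I.input 2 k) T r := by
  by_contra! hlt
  have : ∑ c ∈ Finset.range n, colourCount m (I.input 2 k) T c < ∑ c ∈ Finset.range n, b := by
    refine Finset.sum_lt_sum (fun c hc => ?_) ⟨r, Finset.mem_range.2 hr, hlt⟩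
    have := hT.balanced k c (Finset.mem_range.1 hc) r hr
    omega
  rw [Finset.sum_const, Finset.card_range, smul_eq_mul, mul_comm] at this
  exact absurd ((hb.trans (hT.average k)).trans_lt this) (lt_irrefl _)

theorem IsTable.isAPSFair {T : ℕ → ℕ → ℕ} (hT : I.IsTable T) (hI : I.Dichotomous) {r : ℕ}
    (hr : r < n) : I.IsAPSFair (colourBundles n m T r) := by
  refine ⟨isAllocation_colourBundles T r, fun k => ?_⟩
  rw [hT.groupWelfare_eq hI hr]
  exact anyPriceShare_le (Nat.zero_lt_of_lt hr) hI fun b hb => hT.le_colourCount hr hb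

theorem expectedGroupWelfare_map_uniform (hn : (Finset.range n).Nonempty)
    (f : ℕ → Bundles n m) (G : Finset (Fin n)) :
    I.expectedGroupWelfare ((PMF.uniformOfFinset (Finset.range n) hn).map f) G =
      (∑ r ∈ Finset.range n, (I.groupWelfare (f r) G : ℝ)) / n := by
  classical
  have h : ∀ A, (((PMF.uniformOfFinset (Finset.range n) hn).map f) A).toReal =
      ∑ r ∈ Finset.range n, if A = f r then (n : ℝ)⁻¹ else 0 := by
    intro A
    rw [PMF.map_apply, tsum_eq_sum (s := Finset.range n), ENNReal.toReal_sum]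
    · refine Finset.sum_congr rfl fun r hr => ?_
      rw [PMF.uniformOfFinset_apply_of_mem _ hr, Finset.card_range]
      split_ifs <;> simp
    · intro r hr
      split_ifs
      · exact PMF.apply_ne_top _ _
      · exact ENNReal.zero_ne_top
    · intro r hr
      rw [PMF.uniformOfFinset_apply_of_notMem _ hr, ite_self]
  unfold expectedGroupWelfare
  simp only [h, Finset.sum_mul]
  rw [Finset.sum_comm, Finset.sum_div]
  refine Finset.sum_congr rfl fun r _ => ?_
  simp only [ite_mul, zero_mul]
  rw [Finset.sum_ite_eq', if_pos (Finset.mem_univ _), div_eq_inv_mul]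

theorem IsTable.propShare_le (hn : (Finset.range n).Nonempty) {T : ℕ → ℕ → ℕ} (hT : I.IsTable T)
    (hI : I.Dichotomous) (k : Fin g) :
    (I.propShare (I.group k) : ℝ) ≤ I.expectedGroupWelfare
      ((PMF.uniformOfFinset (Finset.range n) hn).map (colourBundles n m T)) (I.group k) := by
  rw [expectedGroupWelfare_map_uniform, propShare_eq hI]
  push_cast
  gcongr
  rw [Finset.sum_congr rfl fun r hr => by
    rw [hT.groupWelfare_eq hI (Finset.mem_range.1 hr), NNReal.coe_natCast]]
  exact_mod_cast hT.average k

end AllocInstance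

theorem outputAfter_fairProgram {N n m g t : ℕ} {I : AllocInstance n m g} (hn : 0 < n)
    (hI : I.Dichotomous) (hL : I.Laminar) (hN : (n + m + g + 1) ^ 4 + 1 ≤ N)
    (ht : fairProgram.time N ≤ t) :
    ∃ T, I.IsTable T ∧ outputAfter fairProgram I t =
      (PMF.uniformOfFinset (Finset.range n) (Finset.nonempty_range_iff.2 hn.ne')).map
        (colourBundles n m T) := by
  obtain ⟨T, f, hT, hf, hrun⟩ := exists_runFor_fairProgram hn hI hL hN ht
  refine ⟨T, hT, ?_⟩
  rw [outputAfter, hrun, PMF.map_comp]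
  congr 1
  exact funext hf

theorem haltsWithin_fairProgram {N n m g t : ℕ} {I : AllocInstance n m g} (hn : 0 < n)
    (hI : I.Dichotomous) (hL : I.Laminar) (hN : (n + m + g + 1) ^ 4 + 1 ≤ N)
    (ht : fairProgram.time N ≤ t) : HaltsWithin fairProgram I.input t := by
  obtain ⟨T, f, hT, hf, hrun⟩ := exists_runFor_fairProgram hn hI hL hN ht
  intro c hc
  rw [hrun, PMF.mem_support_map_iff] at hc
  obtain ⟨r, -, rfl⟩ := hc
  rfl

theorem isAPSFair_of_mem_support_fairProgram {N n m g t : ℕ} {I : AllocInstance n m g}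
    (hn : 0 < n) (hI : I.Dichotomous) (hL : I.Laminar) (hN : (n + m + g + 1) ^ 4 + 1 ≤ N)
    (ht : fairProgram.time N ≤ t) {A : Bundles n m}
    (hA : A ∈ (outputAfter fairProgram I t).support) : I.IsAPSFair A := by
  obtain ⟨T, hT, hout⟩ := outputAfter_fairProgram hn hI hL hN ht
  rw [hout, PMF.mem_support_map_iff] at hA
  obtain ⟨r, hr, rfl⟩ := hA
  rw [PMF.mem_support_uniformOfFinset_iff, Finset.mem_range] at hr
  exact hT.isAPSFair hI hr

end FairGroups

end

theorem mainTheorem1 :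
    (∀ (n m g : ℕ) (I : FairGroups.AllocInstance n m g),
      0 < n → I.Dichotomous → I.Laminar →
        ∃ A : FairGroups.Bundles n m, I.IsAPSFair A) ∧
    (∃ (P : FairGroups.Cmd) (q : Polynomial ℕ),
      ∀ (n m g : ℕ) (I : FairGroups.AllocInstance n m g),
        0 < n → I.Dichotomous → I.Laminar →
          FairGroups.HaltsWithin P I.input (q.eval (n + m + g)) ∧
          (∀ A ∈ (FairGroups.outputAfter P I (q.eval (n + m + g))).support, I.IsAPSFair A) ∧
          (∀ k : Fin g, (I.propShare (I.group k) : ℝ) ≤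
            I.expectedGroupWelfare (FairGroups.outputAfter P I (q.eval (n + m + g)))
              (I.group k))) := by
  constructor
  · intro n m g I hn hI hL
    obtain ⟨A, hA⟩ := (FairGroups.outputAfter FairGroups.fairProgram I
      (FairGroups.fairProgram.time ((n + m + g + 1) ^ 4 + 1))).support_nonempty
    exact ⟨A, FairGroups.isAPSFair_of_mem_support_fairProgram hn hI hL le_rfl le_rfl hA⟩
  · obtain ⟨p, hp⟩ := FairGroups.fairProgram.exists_polynomial_time
    refine ⟨FairGroups.fairProgram, p.comp ((.X + 1) ^ 4 + 1), fun n m g I hn hI hL => ?_⟩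
    have ht : FairGroups.fairProgram.time ((n + m + g + 1) ^ 4 + 1) ≤
        (p.comp ((.X + 1) ^ 4 + 1)).eval (n + m + g) := by
      simp [hp, Polynomial.eval_comp]
    refine ⟨FairGroups.haltsWithin_fairProgram hn hI hL le_rfl ht, fun A hA =>
      FairGroups.isAPSFair_of_mem_support_fairProgram hn hI hL le_rfl ht hA, fun k => ?_⟩
    obtain ⟨T, hT, hout⟩ := FairGroups.outputAfter_fairProgram hn hI hL le_rfl ht
    rw [hout]
    exact hT.propShare_le _ hI k
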